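/- Let $\mathcal X$ be a data universe with a symmetric neighboring relation $\sim$ (for instance: datasets that differ in one individual's data) for which some two distinct datasets are neighbors, and let $\varepsilon>0$. A mechanism $M:\mathcal X\to\mathcal Y$ assigns to each dataset a probability distribution on an outcome space $\mathcal Y$. It is $\varepsilon$-bounded-range ($\varepsilon$-BR) if for all neighbors $x\sim x'$ and all outcomes $y_1,y_2$, $$\frac{\Pr[M(x)=y_1]}{\Pr[M(x')=y_1]}\le e^{\varepsilon}\,\frac{\Pr[M(x)=y_2]}{\Pr[M(x')=y_2]}$$ (with probability densities in place of probabilities on general outcome spaces; inequalities between ratios are read with denominators multiplied out). It is $(\varepsilon_g,\delta)$-DP if $\Pr[M(x)\in S]\le e^{\varepsilon_g}\Pr[M(x')\in S]+\delta$ for all $x\sim x'$ and all measurable $S\subseteq\mathcal Y$. Put $\delta_{\mathrm{OPT}}(M,\varepsilon_g)=\inf\{\delta: M\text{ is }(\varepsilon_g,\delta)\text{-DP}\}$, and for a class $\mathcal C$ of mechanisms put $\delta_{\mathrm{OPT}}(\mathcal C,\varepsilon_g)=\sup_{M\in\mathcal C}\delta_{\mathrm{OPT}}(M,\varepsilon_g)$.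 Let $\mathcal M^k_{\mathrm{BR}}$ be the nonadaptive family of all mechanisms $x\mapsto(M_1(x),\dots,M_k(x))$ with independent components, where each $M_i$ is $\varepsilon$-BR. Let $\mathcal A^k_{\mathrm{BR}}$ be the adaptive family of all $k$-round games of the following form, each viewed as a mechanism with input $b\in\{0,1\}$, the two values of $b$ being neighbors. An adversary draws an initial coin $r_0$. In each round $i=1,\dots,k$ it selects, as a function of $(r_0,a_1,r_1,\dots,a_{i-1},r_{i-1})$, neighboring datasets $x^{i,0}\sim x^{i,1}$ and an $\varepsilon$-BR mechanism $M_i$, receives the answer $a_i\sim M_i(x^{i,b})$, and draws a coin $r_i$ from a distribution that depends on $(r_0,a_1,\dots,r_{i-1},a_i)$ but not otherwise on $b$. The outcome is the view $(r_0,a_1,r_1,\dots,a_k,r_k)$. Then: 1. if $k\ge 4$, then for every $\varepsilon_g\in[0,(k-3)\varepsilon]$, $$\delta_{\mathrm{OPT}}(\mathcal A^k_{\mathrm{BR}},\varepsilon_g)>\delta_{\mathrm{OPT}}(\mathcal M^k_{\mathrm{BR}},\varepsilon_g);$$ 2. if $k\ge 1$, then for every $\varepsilon_g\ge(k-1)\varepsilon$,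 $$\delta_{\mathrm{OPT}}(\mathcal A^k_{\mathrm{BR}},\varepsilon_g)=\delta_{\mathrm{OPT}}(\mathcal M^k_{\mathrm{BR}},\varepsilon_g).$$ -/

import Mathlib

open MeasureTheory ProbabilityTheory
open scoped ENNReal

universe u v

/-- A randomized mechanism on the data universe `X`: a measurable outcome space together with an
outcome distribution for every dataset. -/
structure Mechanism (X : Type u) where
  /-- the outcome space -/
  Out : Type v
  [instOut : MeasurableSpace Out]
  /-- the distribution of the outcome on each dataset -/
  law : X → ProbabilityMeasure Out

attribute [instance] Mechanism.instOut

/-- `(ε, δ)`-differential privacy with respect to the neighboring relation `nbr`. -/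
def IsDP {X : Type u} (nbr : X → X → Prop) (M : Mechanism.{u, v} X) (ε δ : ℝ) : Prop :=
  ∀ x x' : X, nbr x x' → ∀ S : Set M.Out, MeasurableSet S →
    (M.law x : Measure M.Out).real S ≤
      Real.exp ε * (M.law x' : Measure M.Out).real S + δ

/-- `ε`-bounded range. For neighbors `x, x'` the two outcome laws have densities `p, q` with respect
to a common reference measure (counting measure in the discrete case) such that
`p y₁ / q y₁ ≤ e^ε * (p y₂ / q y₂)` for all outcomes `y₁, y₂`. The inequality is written without
division, so that it makes sense when some densities vanish. -/
def IsBR {X : Type u} (nbr : X → X → Prop) (ε : ℝ) (M : Mechanism.{u, v} X) : Prop :=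
  ∀ x x' : X, nbr x x' →
    ∃ (μ : Measure M.Out) (p q : M.Out → ℝ≥0∞),
      SigmaFinite μ ∧ Measurable p ∧ Measurable q ∧
      (M.law x : Measure M.Out) = μ.withDensity p ∧
      (M.law x' : Measure M.Out) = μ.withDensity q ∧
      ∀ y₁ y₂ : M.Out, p y₁ * q y₂ ≤ ENNReal.ofReal (Real.exp ε) * (p y₂ * q y₁)

/-- The class of `ε`-bounded-range mechanisms on `X`. -/
def classBR {X : Type u} (nbr : X → X → Prop) (ε : ℝ) : Set (Mechanism.{u, v} X) :=
  {M | IsBR nbr ε M}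

/-- The optimal `δ` of a mechanism: `inf {δ : M is (ε, δ)-DP}`. As soon as there is a pair of
neighbors, every such `δ` is nonnegative (take `S = ∅`). -/
noncomputable def deltaOpt {X : Type u} (nbr : X → X → Prop) (M : Mechanism.{u, v} X)
    (ε : ℝ) : ℝ :=
  sInf {δ : ℝ | IsDP nbr M ε δ}

/-- The optimal `δ` of a class of mechanisms: the supremum of the optimal `δ` of its members. -/
noncomputable def deltaOptClass {X : Type u} (nbr : X → X → Prop) (C : Set (Mechanism.{u, v} X))
    (ε : ℝ) : ℝ :=
  sSup ((fun M => deltaOpt nbr M ε) '' C)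

/-- The product `M₁ × ⋯ × Mₖ`: on dataset `x`, run every `Mᵢ` on `x`, independently. -/
noncomputable def Mechanism.prod {X : Type u} {k : ℕ} (M : Fin k → Mechanism.{u, v} X) :
    Mechanism.{u, v} X where
  Out := ∀ i, (M i).Out
  law x := ProbabilityMeasure.pi fun i => (M i).law x

/-- The nonadaptive family `{M₁ × ⋯ × Mₖ : each Mᵢ is ε-BR}`. -/
def nonadaptiveBR {X : Type u} (nbr : X → X → Prop) (ε : ℝ) (k : ℕ) :
    Set (Mechanism.{u, v} X) :=
  {M | ∃ N : Fin k → Mechanism.{u, v} X, (∀ i, N i ∈ classBR nbr ε) ∧ M = Mechanism.prod N}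

/-- The transcripts `(r₀, a₁, r₁, …, aᵢ, rᵢ)` of `i` rounds, where the coin `rⱼ` lies in `R j` and
the answer `aⱼ₊₁` lies in `Y j`. -/
def Transcript (R Y : ℕ → Type v) : ℕ → Type v
  | 0 => R 0
  | i + 1 => (Transcript R Y i × Y i) × R (i + 1)

/-- The product σ-algebra on transcripts. -/
instance Transcript.instMeasurableSpace (R Y : ℕ → Type v) [∀ i, MeasurableSpace (R i)]
    [∀ i, MeasurableSpace (Y i)] : ∀ i, MeasurableSpace (Transcript R Y i)
  | 0 => inferInstanceAs (MeasurableSpace (R 0))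
  | i + 1 =>
    letI := Transcript.instMeasurableSpace R Y i
    inferInstanceAs (MeasurableSpace ((Transcript R Y i × Y i) × R (i + 1)))

/-- An adversary in the adaptive composition game against the classes `E 0, E 1, …` of mechanisms on
`X`. It has a randomized part (its coins) and a deterministic part, which, from the transcript of
the first `i` rounds, selects the two neighboring datasets and the mechanism of class `E i` for the
next round. A game of `k` rounds uses only the data of the rounds `i < k`. -/
structure Adversary {X : Type u} (nbr : X → X → Prop) (E : ℕ → Set (Mechanism.{u, v} X)) where
  /-- the coin spaces -/
  R : ℕ → Type v
  /-- the answer spaces -/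
  Y : ℕ → Type v
  [instR : ∀ i, MeasurableSpace (R i)]
  [instY : ∀ i, MeasurableSpace (Y i)]
  /-- the law of the initial coin `r₀` -/
  init : ProbabilityMeasure (R 0)
  /-- the law of the coin drawn after an answer, given the transcript and the answer -/
  coin : ∀ i, Kernel (Transcript R Y i × Y i) (R (i + 1))
  coin_markov : ∀ i, IsMarkovKernel (coin i)
  /-- the pair of datasets selected after a transcript, indexed by the secret bit -/
  data : ∀ i, Transcript R Y i → Bool → X
  data_nbr : ∀ i h, nbr (data i h false) (data i h true)
  /-- the mechanism selected after a transcript -/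
  mech : ∀ i, Transcript R Y i → X → ProbabilityMeasure (Y i)
  mech_mem : ∀ i h, (⟨Y i, mech i h⟩ : Mechanism.{u, v} X) ∈ E i
  /-- the law of the answer is a measurable function of the transcript, so that the law of the
  transcript is well defined (automatic when all coin and answer spaces are discrete and countable) -/
  answer_measurable : ∀ i b,
    Measurable fun h => (mech i h (data i h b) : Measure (Y i))

namespace Adversary

variable {X : Type u} {nbr : X → X → Prop} {E : ℕ → Set (Mechanism.{u, v} X)}

attribute [instance] Adversary.instR Adversary.instY Adversary.coin_markov

/-- The law of the answer in a round, given the transcript so far, when the secret bit is `b`. -/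
noncomputable def answer (A : Adversary.{u, v} nbr E) (b : Bool) (i : ℕ) :
    Kernel (Transcript A.R A.Y i) (A.Y i) where
  toFun h := (A.mech i h (A.data i h b) : Measure (A.Y i))
  measurable' := A.answer_measurable i b

instance (A : Adversary.{u, v} nbr E) (b : Bool) (i : ℕ) : IsMarkovKernel (A.answer b i) :=
  ⟨fun h => inferInstanceAs
    (IsProbabilityMeasure (A.mech i h (A.data i h b) : Measure (A.Y i)))⟩

/-- The law of the transcript of the first `i` rounds when the secret bit is `b`: a round draws an
answer given the transcript, then a coin given the transcript and that answer. -/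
noncomputable def view (A : Adversary.{u, v} nbr E) (b : Bool) :
    ∀ i, Measure (Transcript A.R A.Y i)
  | 0 => (A.init : Measure (A.R 0))
  | i + 1 => ((A.view b i) ⊗ₘ (A.answer b i)) ⊗ₘ (A.coin i)

theorem isProbabilityMeasure_view (A : Adversary.{u, v} nbr E) (b : Bool) :
    ∀ i, IsProbabilityMeasure (A.view b i)
  | 0 => inferInstanceAs (IsProbabilityMeasure (A.init : Measure (A.R 0)))
  | i + 1 =>
    haveI := isProbabilityMeasure_view A b i
    inferInstanceAs
      (IsProbabilityMeasure (((A.view b i) ⊗ₘ (A.answer b i)) ⊗ₘ (A.coin i)))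

/-- The `k`-round adaptive composition game as a mechanism: its input is the secret bit and its
outcome is the adversary's view. -/
noncomputable def game (A : Adversary.{u, v} nbr E) (k : ℕ) : Mechanism.{0, v} Bool where
  Out := Transcript A.R A.Y k
  law b := ⟨A.view b k, A.isProbabilityMeasure_view b k⟩

end Adversary

/-- The adaptive family: the `k`-round games of all adversaries that select `ε`-BR mechanisms. -/
def adaptiveBR {X : Type u} (nbr : X → X → Prop) (ε : ℝ) (k : ℕ) :
    Set (Mechanism.{0, v} Bool) :=
  {G | ∃ A : Adversary.{u, v} nbr (fun _ => classBR nbr ε), G = A.game k}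

/-- The optimal `δ` of the nonadaptive composition of `k` mechanisms that are `ε`-BR. -/
noncomputable def deltaNonadaptive {X : Type u} (nbr : X → X → Prop) (ε : ℝ) (k : ℕ)
    (εg : ℝ) : ℝ :=
  deltaOptClass nbr (nonadaptiveBR.{u, v} nbr ε k) εg

/-- The optimal `δ` of the `k`-fold adaptive composition of `ε`-BR mechanisms. The two values of the
secret bit are neighbors. -/
noncomputable def deltaAdaptive {X : Type u} (nbr : X → X → Prop) (ε : ℝ) (k : ℕ)
    (εg : ℝ) : ℝ :=
  deltaOptClass (fun b b' : Bool => b ≠ b') (adaptiveBR.{u, v} nbr ε k) εg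

/-! For outcome laws `P`, `Q` with likelihood ratio `W = dQ/dP`, the maximum of `P S - c * Q S` over
events `S` is the `P`-mean of `(1 - c W)₊`, attained at `{c W < 1}`. Bounded range confines the
ratio of one round to some interval `[e^(-ε t), e^(ε (1 - t))]` with `t ∈ [0, 1]`, and its mean is
`1`. Values of future rounds are convex in the current ratio, so by the chord inequality the worst
ratio is the two-point one on the endpoints. The problem becomes a game: from `x = e^εg`, each step
multiplies `x` by one of the two endpoints, and the final payoff is `(1 - x)₊`. The nonadaptive
optimum is the best `fixedValue`, where the list of parameters is chosen in advance. The adaptive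
optimum is the Bellman value `optValue`, attained by an explicit adversary.

For `εg ≥ (k - 1) ε`, any single up-step makes the remaining value zero. Only the all-down path
counts, and the choices along one path form a fixed list (`optValue_le_of_fixedValue_le`).

For the strict inequality write `x = e^(ε y)`; a step sends `y` to `y - t` or `y + 1 - t`. Suppose
that a fixed list were optimal. Steps commute, so every permutation is optimal, and after any prefix
the rest is optimal at each state reached with positive probability. Hence each `t` in the list,
played last, is optimal at all states that the other steps reach, and these are spaced by `1`. With
one round left the optimal step at `-1 < y < 1` is uniquely `(1 + y) / 2`
(`FixedOptimal.eq_of_singleton`). Two states in that window would demand two values of `t`, so the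
only state there is `0` and `t = 1/2`. All steps are therefore `1/2`. But then the state `3/2` is
reachable with two rounds left, where two half-steps earn nothing although the optimum is positive
(`not_fixedOptimal`). A best fixed list exists by compactness, so the strict inequality passes to
the suprema. -/

/-! ### Two-point steps and the values of fixed and optimal strategies -/

/-- The probability of the answer with the smaller likelihood ratio `e^(-ε t)` under the
two-outcome `ε`-bounded-range pair with likelihood ratios `e^(-ε t)` and `e^(ε (1 - t))`. -/
noncomputable def downProb (ε t : ℝ) : ℝ :=
  (1 - Real.exp (ε * (t - 1))) / (1 - Real.exp (-ε))

/-- The average of `φ` after one multiplicative two-point step from `x`. -/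
noncomputable def stepAvg (ε t : ℝ) (φ : ℝ → ℝ) (x : ℝ) : ℝ :=
  downProb ε t * φ (x * Real.exp (-(ε * t))) +
    (1 - downProb ε t) * φ (x * Real.exp (ε * (1 - t)))

/-- The expected payoff `(1 - x)₊` after the two-point steps with the given parameters. -/
noncomputable def fixedValue (ε : ℝ) : List ℝ → ℝ → ℝ
  | [] => fun x => max (1 - x) 0
  | t :: L => stepAvg ε t (fixedValue ε L)

/-- The optimal expected payoff `(1 - x)₊` after `m` adaptively chosen two-point steps. -/
noncomputable def optValue (ε : ℝ) : ℕ → ℝ → ℝ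
  | 0 => fun x => max (1 - x) 0
  | m + 1 => fun x => sSup ((fun t => stepAvg ε t (optValue ε m) x) '' Set.Icc 0 1)

theorem one_sub_exp_neg_pos {ε : ℝ} (hε : 0 < ε) : 0 < 1 - Real.exp (-ε) := by
  have := Real.exp_lt_one_iff.2 (show -ε < 0 by linarith)
  linarith

theorem downProb_nonneg {ε t : ℝ} (hε : 0 < ε) (ht : t ≤ 1) : 0 ≤ downProb ε t := by
  refine div_nonneg ?_ (one_sub_exp_neg_pos hε).le
  have := Real.exp_le_one_iff.2 (show ε * (t - 1) ≤ 0 by nlinarith)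
  linarith

theorem downProb_pos {ε t : ℝ} (hε : 0 < ε) (ht : t < 1) : 0 < downProb ε t := by
  refine div_pos ?_ (one_sub_exp_neg_pos hε)
  have := Real.exp_lt_one_iff.2 (show ε * (t - 1) < 0 by nlinarith)
  linarith

theorem downProb_le_one {ε t : ℝ} (hε : 0 < ε) (ht : 0 ≤ t) : downProb ε t ≤ 1 := by
  rw [downProb, div_le_one (one_sub_exp_neg_pos hε)]
  have := Real.exp_le_exp.2 (show -ε ≤ ε * (t - 1) by nlinarith)
  linarith

theorem downProb_lt_one {ε t : ℝ} (hε : 0 < ε) (ht : 0 < t) : downProb ε t < 1 := by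
  rw [downProb, div_lt_one (one_sub_exp_neg_pos hε)]
  have := Real.exp_lt_exp.2 (show -ε < ε * (t - 1) by nlinarith)
  linarith

theorem downProb_zero {ε : ℝ} (hε : 0 < ε) : downProb ε 0 = 1 := by
  have := (one_sub_exp_neg_pos hε).ne'
  simp [downProb, this]

theorem downProb_one (ε : ℝ) : downProb ε 1 = 0 := by
  simp [downProb]

theorem exp_up_eq (ε t : ℝ) :
    Real.exp (ε * (1 - t)) = Real.exp ε * Real.exp (-(ε * t)) := by
  rw [← Real.exp_add]; ring_nf

theorem downProb_eq (ε t : ℝ) :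
    downProb ε t = (1 - Real.exp (-ε) / Real.exp (-(ε * t))) / (1 - Real.exp (-ε)) := by
  rw [downProb, ← Real.exp_sub]; ring_nf

/-- A likelihood ratio has mean `1` under the base law; for the two given endpoints this determines
`downProb`. -/
theorem downProb_mean {ε : ℝ} (hε : 0 < ε) (t : ℝ) :
    downProb ε t * Real.exp (-(ε * t)) + (1 - downProb ε t) * Real.exp (ε * (1 - t)) = 1 := by
  have h := (one_sub_exp_neg_pos hε).ne'
  rw [exp_up_eq, downProb_eq]
  rw [Real.exp_neg ε] at *
  have h1 := (Real.exp_pos ε).ne'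
  have h2 := (Real.exp_pos (-(ε * t))).ne'
  have h3 : Real.exp ε - 1 ≠ 0 := by
    have := Real.add_one_lt_exp hε.ne'
    intro h; linarith
  field_simp
  ring

theorem continuous_downProb (ε : ℝ) : Continuous (downProb ε) := by
  unfold downProb; fun_prop

theorem stepAvg_zero {ε : ℝ} (hε : 0 < ε) (φ : ℝ → ℝ) (x : ℝ) : stepAvg ε 0 φ x = φ x := by
  simp [stepAvg, downProb_zero hε]

theorem stepAvg_one (ε : ℝ) (φ : ℝ → ℝ) (x : ℝ) : stepAvg ε 1 φ x = φ x := by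
  simp [stepAvg, downProb_one]

/-- The factors of two independent steps multiply, so their order is irrelevant. This is the
symmetry that adaptive strategies lack. -/
theorem stepAvg_comm (ε t u : ℝ) (φ : ℝ → ℝ) :
    stepAvg ε t (stepAvg ε u φ) = stepAvg ε u (stepAvg ε t φ) := by
  funext x
  simp only [stepAvg]
  rw [mul_right_comm x (Real.exp (-(ε * t))) (Real.exp (-(ε * u))),
    mul_right_comm x (Real.exp (-(ε * t))) (Real.exp (ε * (1 - u))),
    mul_right_comm x (Real.exp (ε * (1 - t))) (Real.exp (-(ε * u))),
    mul_right_comm x (Real.exp (ε * (1 - t))) (Real.exp (ε * (1 - u)))]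
  ring

theorem stepAvg_mono {ε t : ℝ} (hε : 0 < ε) (ht : t ∈ Set.Icc (0 : ℝ) 1) {φ ψ : ℝ → ℝ}
    (h : ∀ x, φ x ≤ ψ x) (x : ℝ) : stepAvg ε t φ x ≤ stepAvg ε t ψ x := by
  have h0 := downProb_nonneg hε ht.2
  have h1 := downProb_le_one hε ht.1
  exact add_le_add (mul_le_mul_of_nonneg_left (h _) h0)
    (mul_le_mul_of_nonneg_left (h _) (by linarith))

theorem stepAvg_nonneg {ε t : ℝ} (hε : 0 < ε) (ht : t ∈ Set.Icc (0 : ℝ) 1) {φ : ℝ → ℝ}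
    (h : ∀ x, 0 ≤ φ x) (x : ℝ) : 0 ≤ stepAvg ε t φ x := by
  have h0 := downProb_nonneg hε ht.2
  have h1 := downProb_le_one hε ht.1
  exact add_nonneg (mul_nonneg h0 (h _)) (mul_nonneg (by linarith) (h _))

theorem convexOn_stepAvg {ε t : ℝ} (hε : 0 < ε) (ht : t ∈ Set.Icc (0 : ℝ) 1) {φ : ℝ → ℝ}
    (h : ConvexOn ℝ Set.univ φ) : ConvexOn ℝ Set.univ (stepAvg ε t φ) := by
  have h0 := downProb_nonneg hε ht.2
  have h1 := downProb_le_one hε ht.1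
  refine ⟨convex_univ, fun x _ y _ a b ha hb hab => ?_⟩
  have key : ∀ e : ℝ, φ ((a * x + b * y) * e) ≤ a * φ (x * e) + b * φ (y * e) := by
    intro e
    have := h.2 (Set.mem_univ (x * e)) (Set.mem_univ (y * e)) ha hb hab
    simp only [smul_eq_mul] at this
    rwa [show (a * x + b * y) * e = a * (x * e) + b * (y * e) by ring]
  simp only [stepAvg, smul_eq_mul]
  have k1 := mul_le_mul_of_nonneg_left (key (Real.exp (-(ε * t)))) h0
  have k2 := mul_le_mul_of_nonneg_left (key (Real.exp (ε * (1 - t)))) (sub_nonneg.2 h1)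
  linarith

theorem convexOn_payoff : ConvexOn ℝ Set.univ (fun x : ℝ => max (1 - x) 0) := by
  have h1 : ConvexOn ℝ Set.univ (fun x : ℝ => 1 - x) :=
    (convexOn_const 1 convex_univ).sub (concaveOn_id convex_univ)
  exact h1.sup (convexOn_const 0 convex_univ)

theorem convexOn_fixedValue {ε : ℝ} (hε : 0 < ε) {L : List ℝ}
    (hL : ∀ t ∈ L, t ∈ Set.Icc (0 : ℝ) 1) : ConvexOn ℝ Set.univ (fixedValue ε L) := by
  induction L with
  | nil => exact convexOn_payoff
  | cons t L ih =>
    exact convexOn_stepAvg hε (hL t (by simp)) (ih fun u hu => hL u (by simp [hu]))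

theorem fixedValue_nonneg {ε : ℝ} (hε : 0 < ε) {L : List ℝ}
    (hL : ∀ t ∈ L, t ∈ Set.Icc (0 : ℝ) 1) (x : ℝ) : 0 ≤ fixedValue ε L x := by
  induction L generalizing x with
  | nil => exact le_max_right _ _
  | cons t L ih =>
    exact stepAvg_nonneg hε (hL t (by simp)) (ih fun u hu => hL u (by simp [hu])) x

theorem ConvexOn.continuous_of_univ {φ : ℝ → ℝ} (h : ConvexOn ℝ Set.univ φ) : Continuous φ :=
  continuousOn_univ.1 (h.continuousOn isOpen_univ)

theorem continuous_stepAvg_param (ε : ℝ) {φ : ℝ → ℝ} (h : Continuous φ) (x : ℝ) :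
    Continuous fun t => stepAvg ε t φ x := by
  have := continuous_downProb ε
  unfold stepAvg; fun_prop

theorem exists_isGreatest_stepAvg (ε : ℝ) {φ : ℝ → ℝ} (h : Continuous φ) (x : ℝ) :
    ∃ t ∈ Set.Icc (0 : ℝ) 1, IsGreatest ((fun t => stepAvg ε t φ x) '' Set.Icc 0 1)
      (stepAvg ε t φ x) := by
  obtain ⟨t, ht, hmax⟩ := isCompact_Icc.exists_isMaxOn (Set.nonempty_Icc.2 zero_le_one)
    (continuous_stepAvg_param ε h x).continuousOn
  refine ⟨t, ht, Set.mem_image_of_mem _ ht, ?_⟩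
  rintro _ ⟨u, hu, rfl⟩
  exact hmax hu

/-- A supremum of convex functions is convex. Convexity on all of `ℝ` also gives continuity, so the
supremum over the compact parameter interval is attained. -/
theorem convexOn_optValue {ε : ℝ} (hε : 0 < ε) (m : ℕ) :
    ConvexOn ℝ Set.univ (optValue ε m) := by
  induction m with
  | zero => exact convexOn_payoff
  | succ m ih =>
    refine ⟨convex_univ, fun x _ y _ a b ha hb hab => ?_⟩
    obtain ⟨t, ht, hmax⟩ := exists_isGreatest_stepAvg ε ih.continuous_of_univ (a • x + b • y)
    obtain ⟨_, _, hx⟩ := exists_isGreatest_stepAvg ε ih.continuous_of_univ x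
    obtain ⟨_, _, hy⟩ := exists_isGreatest_stepAvg ε ih.continuous_of_univ y
    simp only [optValue]
    rw [hmax.csSup_eq]
    refine ((convexOn_stepAvg hε ht ih).2 trivial trivial ha hb hab).trans ?_
    exact add_le_add
      (mul_le_mul_of_nonneg_left (le_csSup ⟨_, hx.2⟩ (Set.mem_image_of_mem _ ht)) ha)
      (mul_le_mul_of_nonneg_left (le_csSup ⟨_, hy.2⟩ (Set.mem_image_of_mem _ ht)) hb)

theorem stepAvg_le_optValue {ε : ℝ} (hε : 0 < ε) (m : ℕ) {t : ℝ} (ht : t ∈ Set.Icc (0 : ℝ) 1)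
    (x : ℝ) : stepAvg ε t (optValue ε m) x ≤ optValue ε (m + 1) x := by
  obtain ⟨_, _, hx⟩ :=
    exists_isGreatest_stepAvg ε (convexOn_optValue hε m).continuous_of_univ x
  exact le_csSup ⟨_, hx.2⟩ (Set.mem_image_of_mem _ ht)

theorem exists_optValue_succ_eq {ε : ℝ} (hε : 0 < ε) (m : ℕ) (x : ℝ) :
    ∃ t ∈ Set.Icc (0 : ℝ) 1, optValue ε (m + 1) x = stepAvg ε t (optValue ε m) x := by
  obtain ⟨t, ht, hx⟩ :=
    exists_isGreatest_stepAvg ε (convexOn_optValue hε m).continuous_of_univ x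
  exact ⟨t, ht, hx.csSup_eq⟩

theorem fixedValue_le_optValue {ε : ℝ} (hε : 0 < ε) {L : List ℝ}
    (hL : ∀ t ∈ L, t ∈ Set.Icc (0 : ℝ) 1) (x : ℝ) :
    fixedValue ε L x ≤ optValue ε L.length x := by
  induction L generalizing x with
  | nil => exact le_rfl
  | cons t L ih =>
    exact (stepAvg_mono hε (hL t (by simp)) (ih fun u hu => hL u (by simp [hu])) x).trans
      (stepAvg_le_optValue hε _ (hL t (by simp)) x)

theorem optValue_nonneg {ε : ℝ} (hε : 0 < ε) (m : ℕ) (x : ℝ) : 0 ≤ optValue ε m x := by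
  have hL : ∀ t ∈ List.replicate m (0 : ℝ), t ∈ Set.Icc (0 : ℝ) 1 := fun t ht => by
    rw [List.eq_of_mem_replicate ht]; simp
  simpa using (fixedValue_nonneg hε hL x).trans (fixedValue_le_optValue hε hL x)

/-- A convex function is below its chord between the two endpoints of a step; at the mean `1` the
chord is the two-point average. -/
theorem ConvexOn.exists_chord {ε t : ℝ} (hε : 0 < ε) {φ : ℝ → ℝ}
    (h : ConvexOn ℝ Set.univ φ) (x : ℝ) :
    ∃ A B : ℝ, A + B = stepAvg ε t φ x ∧
      ∀ z ∈ Set.Icc (Real.exp (-(ε * t))) (Real.exp (ε * (1 - t))), φ (x * z) ≤ A + B * z := by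
  have hlt : Real.exp (-(ε * t)) < Real.exp (ε * (1 - t)) :=
    Real.exp_lt_exp.2 (by nlinarith)
  have hmean := downProb_mean hε t
  set α := Real.exp (-(ε * t))
  set β := Real.exp (ε * (1 - t))
  have hd : 0 < β - α := by linarith
  have hd' := hd.ne'
  refine ⟨(β * φ (x * α) - α * φ (x * β)) / (β - α), (φ (x * β) - φ (x * α)) / (β - α), ?_, ?_⟩
  · have hp : downProb ε t = (β - 1) / (β - α) := by
      field_simp; linarith
    change _ = downProb ε t * φ (x * α) + (1 - downProb ε t) * φ (x * β)
    rw [hp]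
    field_simp
    ring
  · intro z hz
    have := h.2 (Set.mem_univ (x * α)) (Set.mem_univ (x * β))
      (div_nonneg (sub_nonneg.2 hz.2) hd.le) (div_nonneg (sub_nonneg.2 hz.1) hd.le)
      (by field_simp; ring)
    simp only [smul_eq_mul] at this
    have e1 : (β - z) / (β - α) * (x * α) + (z - α) / (β - α) * (x * β) = x * z := by
      field_simp; ring
    rw [e1] at this
    refine this.trans (le_of_eq ?_)
    field_simp
    ring

/-- Each step divides the state by at most `e^ε`, so after `m` steps it is still at least `1`, where
the payoff vanishes. -/
theorem optValue_eq_zero {ε : ℝ} (hε : 0 < ε) (m : ℕ) {x : ℝ} (hx : Real.exp (ε * m) ≤ x) :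
    optValue ε m x = 0 := by
  induction m generalizing x with
  | zero =>
    simp at hx
    exact max_eq_right (by linarith)
  | succ m ih =>
    obtain ⟨t, ht, h⟩ := exists_optValue_succ_eq hε m x
    have key : ∀ e : ℝ, -ε ≤ e → Real.exp (ε * m) ≤ x * Real.exp e := by
      intro e he
      calc Real.exp (ε * m) = Real.exp (ε * (m + 1 : ℕ)) * Real.exp (-ε) := by
            rw [← Real.exp_add]; push_cast; ring_nf
        _ ≤ x * Real.exp e :=
            mul_le_mul hx (Real.exp_le_exp.2 he) (Real.exp_pos _).le
              ((Real.exp_pos _).le.trans hx)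
    rw [h, stepAvg, ih (key _ (by nlinarith [ht.2])), ih (key _ (by nlinarith [ht.2]))]
    ring

/-- From `e^(ε (m - 1))` on only the path of down-steps matters, so that no adaptivity is
needed. -/
theorem optValue_le_of_fixedValue_le {ε : ℝ} (hε : 0 < ε) (m : ℕ) {x δ : ℝ}
    (hx : Real.exp (ε * (m - 1)) ≤ x)
    (h : ∀ L : List ℝ, L.length = m → (∀ t ∈ L, t ∈ Set.Icc (0 : ℝ) 1) → fixedValue ε L x ≤ δ) :
    optValue ε m x ≤ δ := by
  induction m generalizing x δ with
  | zero => exact h [] rfl (by simp)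
  | succ m ih =>
    obtain ⟨t, ht, hopt⟩ := exists_optValue_succ_eq hε m x
    have hδ : 0 ≤ δ :=
      (fixedValue_nonneg hε (L := List.replicate (m + 1) 0) (fun t ht => by
        rw [List.eq_of_mem_replicate ht]; simp) x).trans
      (h _ (by simp) (fun t ht => by rw [List.eq_of_mem_replicate ht]; simp))
    push_cast at hx
    rw [add_sub_cancel_right] at hx
    have hup : optValue ε m (x * Real.exp (ε * (1 - t))) = 0 := by
      refine optValue_eq_zero hε m (hx.trans ?_)
      have := Real.one_le_exp (show 0 ≤ ε * (1 - t) by nlinarith [ht.2])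
      nlinarith [Real.exp_pos (ε * m)]
    rw [hopt, stepAvg, hup, mul_zero, add_zero]
    rcases (downProb_nonneg hε ht.2).eq_or_lt with hp | hp
    · rw [← hp, zero_mul]; exact hδ
    · rw [mul_comm, ← le_div_iff₀ hp]
      -- The bound `δ` is free in the induction: the remaining rounds are compared with `δ` divided
      -- by the probability of the down-step.
      refine ih ?_ fun L hlen hL => ?_
      · calc Real.exp (ε * (m - 1)) = Real.exp (ε * m) * Real.exp (-ε) := by
              rw [← Real.exp_add]; ring_nf
          _ ≤ x * Real.exp (-(ε * t)) :=
              mul_le_mul hx (Real.exp_le_exp.2 (by nlinarith [ht.2])) (Real.exp_pos _).le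
                ((Real.exp_pos _).le.trans hx)
      · rw [le_div_iff₀ hp, mul_comm]
        have hL' : ∀ u ∈ t :: L, u ∈ Set.Icc (0 : ℝ) 1 := by
          intro u hu
          rcases List.mem_cons.1 hu with rfl | hu
          exacts [ht, hL u hu]
        refine le_trans ?_ (h (t :: L) (by simp [hlen]) hL')
        have := mul_nonneg (sub_nonneg.2 (downProb_le_one hε ht.1))
          (fixedValue_nonneg hε hL (x * Real.exp (ε * (1 - t))))
        simp only [fixedValue, stepAvg]
        linarith

/-- Continuity is joint because the first parameter also moves the point at which the remaining
value is evaluated. -/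
theorem continuous_fixedValue_ofFn (ε : ℝ) (k : ℕ) :
    Continuous fun q : (Fin k → ℝ) × ℝ => fixedValue ε (List.ofFn q.1) q.2 := by
  induction k with
  | zero => simp only [List.ofFn_zero, fixedValue]; fun_prop
  | succ k ih =>
    simp only [List.ofFn_succ, fixedValue, stepAvg]
    have hp := continuous_downProb ε
    have h1 : Continuous fun q : (Fin (k + 1) → ℝ) × ℝ =>
        ((fun i => q.1 (Fin.succ i) : Fin k → ℝ), q.2 * Real.exp (-(ε * q.1 0))) := by fun_prop
    have h2 : Continuous fun q : (Fin (k + 1) → ℝ) × ℝ =>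
        ((fun i => q.1 (Fin.succ i) : Fin k → ℝ), q.2 * Real.exp (ε * (1 - q.1 0))) := by fun_prop
    have h3 : Continuous fun q : (Fin (k + 1) → ℝ) × ℝ => downProb ε (q.1 0) := by fun_prop
    exact (h3.mul (ih.comp h1)).add ((continuous_const.sub h3).mul (ih.comp h2))

/-- An attained maximum is what keeps the inequality strict when passing to the supremum over fixed
lists. -/
theorem exists_isMaxOn_fixedValue (ε : ℝ) (k : ℕ) (x : ℝ) :
    ∃ L : List ℝ, L.length = k ∧ (∀ t ∈ L, t ∈ Set.Icc (0 : ℝ) 1) ∧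
      ∀ L' : List ℝ, L'.length = k → (∀ t ∈ L', t ∈ Set.Icc (0 : ℝ) 1) →
        fixedValue ε L' x ≤ fixedValue ε L x := by
  have hc : Continuous fun t : Fin k → ℝ => fixedValue ε (List.ofFn t) x :=
    (continuous_fixedValue_ofFn ε k).comp (Continuous.prodMk_left x)
  obtain ⟨t, ht, hmax⟩ := (isCompact_univ_pi fun _ : Fin k => isCompact_Icc (a := (0 : ℝ))
    (b := 1)).exists_isMaxOn ⟨fun _ => 0, fun _ _ => by simp⟩ hc.continuousOn
  refine ⟨List.ofFn t, by simp, ?_, ?_⟩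
  · intro u hu
    obtain ⟨i, rfl⟩ := (List.mem_ofFn' _ _).1 hu
    exact ht i trivial
  · rintro L' rfl hL'
    have := hmax (show L'.get ∈ Set.univ.pi fun _ => Set.Icc (0 : ℝ) 1 from
      fun i _ => hL' _ (List.get_mem _ _))
    simpa only [Set.mem_ofPred_eq, List.ofFn_get] using this

/-! ### Fixed strategies are not optimal among adaptive ones -/

/-- The fixed strategy `L` is optimal among all adaptive strategies started at `e^(ε y)`. -/
def FixedOptimal (ε : ℝ) (L : List ℝ) (y : ℝ) : Prop :=
  (∀ t ∈ L, t ∈ Set.Icc (0 : ℝ) 1) ∧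
    optValue ε L.length (Real.exp (ε * y)) ≤ fixedValue ε L (Real.exp (ε * y))

theorem fixedValue_perm (ε : ℝ) {L L' : List ℝ} (h : L.Perm L') :
    fixedValue ε L = fixedValue ε L' := by
  induction h with
  | nil => rfl
  | cons t _ ih => simp only [fixedValue, ih]
  | swap t u L => simp only [fixedValue]; exact stepAvg_comm _ _ _ _
  | trans _ _ ih1 ih2 => exact ih1.trans ih2

theorem exp_down (ε y t : ℝ) :
    Real.exp (ε * y) * Real.exp (-(ε * t)) = Real.exp (ε * (y - t)) := by
  rw [← Real.exp_add]; ring_nf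

theorem exp_up (ε y t : ℝ) :
    Real.exp (ε * y) * Real.exp (ε * (1 - t)) = Real.exp (ε * (y + 1 - t)) := by
  rw [← Real.exp_add]; ring_nf

namespace FixedOptimal

variable {ε : ℝ} {L L' : List ℝ} {t y : ℝ}

theorem perm (h : FixedOptimal ε L y) (hp : L.Perm L') : FixedOptimal ε L' y :=
  ⟨fun t ht => h.1 t (hp.mem_iff.2 ht), by rw [← hp.length_eq, ← fixedValue_perm ε hp]; exact h.2⟩

/-- An average can reach the optimum only if every branch of positive probability does: the other
branch is at most its own optimum, so a deficit on this one could not be made up. -/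
theorem down (hε : 0 < ε) (h : FixedOptimal ε (t :: L) y) (ht : t < 1) :
    FixedOptimal ε L (y - t) := by
  have hL : ∀ u ∈ L, u ∈ Set.Icc (0 : ℝ) 1 := fun u hu => h.1 u (by simp [hu])
  have ht' := h.1 t (by simp)
  refine ⟨hL, ?_⟩
  have h1 := (stepAvg_le_optValue hε L.length ht' _).trans h.2
  simp only [fixedValue, stepAvg, exp_down, exp_up] at h1
  have h2 := fixedValue_le_optValue hε hL (Real.exp (ε * (y + 1 - t)))
  have h3 := mul_le_mul_of_nonneg_left h2 (sub_nonneg.2 (downProb_le_one hε ht'.1))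
  exact le_of_mul_le_mul_left (by linarith) (downProb_pos hε ht)

theorem up (hε : 0 < ε) (h : FixedOptimal ε (t :: L) y) (ht : 0 < t) :
    FixedOptimal ε L (y + 1 - t) := by
  have hL : ∀ u ∈ L, u ∈ Set.Icc (0 : ℝ) 1 := fun u hu => h.1 u (by simp [hu])
  have ht' := h.1 t (by simp)
  refine ⟨hL, ?_⟩
  have h1 := (stepAvg_le_optValue hε L.length ht' _).trans h.2
  simp only [fixedValue, stepAvg, exp_down, exp_up] at h1
  have h2 := fixedValue_le_optValue hε hL (Real.exp (ε * (y - t)))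
  have h3 := mul_le_mul_of_nonneg_left h2 (downProb_nonneg hε ht'.2)
  exact le_of_mul_le_mul_left (by linarith) (sub_pos.2 (downProb_lt_one hε ht))

/-- Along a prefix of nondegenerate steps every number `j` of up-steps has positive probability. -/
theorem walk (hε : 0 < ε) (h : FixedOptimal ε (L ++ L') y)
    (hL : ∀ t ∈ L, t ∈ Set.Ioo (0 : ℝ) 1) {j : ℕ} (hj : j ≤ L.length) :
    FixedOptimal ε L' (y - L.sum + j) := by
  induction L generalizing y j with
  | nil =>
    obtain rfl : j = 0 := by simpa using hj
    simpa using h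
  | cons t L ih =>
    have ht := hL t (by simp)
    have hL' : ∀ u ∈ L, u ∈ Set.Ioo (0 : ℝ) 1 := fun u hu => hL u (by simp [hu])
    rcases j with _ | j
    · have := ih (down hε h ht.2) hL' (Nat.zero_le _)
      convert this using 1
      simp only [List.sum_cons]; ring
    · have := ih (up hε h ht.1) hL' (Nat.le_of_succ_le_succ hj)
      convert this using 1
      simp only [List.sum_cons]; push_cast; ring

theorem of_degenerate_append (hε : 0 < ε) (h : FixedOptimal ε (L ++ L') y)
    (hL : ∀ t ∈ L, t = 0 ∨ t = 1) : FixedOptimal ε L' y := by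
  induction L with
  | nil => exact h
  | cons t L ih =>
    refine ih ?_ fun u hu => hL u (by simp [hu])
    rcases hL t (by simp) with rfl | rfl
    · simpa using down hε h zero_lt_one
    · simpa using up hε h zero_lt_one

end FixedOptimal

theorem fixedValue_degenerate_append {ε : ℝ} (hε : 0 < ε) {L : List ℝ} (L' : List ℝ)
    (hL : ∀ t ∈ L, t = 0 ∨ t = 1) : fixedValue ε (L ++ L') = fixedValue ε L' := by
  induction L with
  | nil => rfl
  | cons t L ih =>
    rw [← ih fun u hu => hL u (by simp [hu])]
    funext x
    rcases hL t (by simp) with rfl | rfl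
    · exact stepAvg_zero hε _ _
    · exact stepAvg_one _ _ _

theorem optValue_pos {ε : ℝ} (hε : 0 < ε) (m : ℕ) {y : ℝ} (hy : y < m) :
    0 < optValue ε m (Real.exp (ε * y)) := by
  induction m generalizing y with
  | zero =>
    refine lt_max_of_lt_left (sub_pos.2 (Real.exp_lt_one_iff.2 ?_))
    push_cast at hy
    nlinarith
  | succ m ih =>
    push_cast at hy
    -- The parameter is the midpoint of `y - m` and `1`, cut off at `0`: below `1`, so the down-step
    -- has positive probability, and above `y - m`, so it lands below `m`.
    have h0 : 0 ≤ max 0 ((y - m + 1) / 2) := le_max_left _ _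
    have h1 : max 0 ((y - m + 1) / 2) < 1 := max_lt one_pos (by linarith)
    have h2 : (y - m + 1) / 2 ≤ max 0 ((y - m + 1) / 2) := le_max_right _ _
    set t := max 0 ((y - m + 1) / 2)
    refine lt_of_lt_of_le ?_ (stepAvg_le_optValue hε m ⟨h0, h1.le⟩ _)
    rw [stepAvg, exp_down]
    have := mul_pos (downProb_pos hε h1) (ih (y := y - t) (by linarith))
    have := mul_nonneg (sub_nonneg.2 (downProb_le_one hε h0))
      (optValue_nonneg hε m (Real.exp (ε * y) * Real.exp (ε * (1 - t))))
    linarith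

/-- The lowest reachable exponent is `y - L.sum`; when it is nonnegative, no path has positive
payoff. -/
theorem fixedValue_eq_zero {ε : ℝ} (hε : 0 < ε) {L : List ℝ}
    (hL : ∀ t ∈ L, t ∈ Set.Icc (0 : ℝ) 1) {y : ℝ} (hy : L.sum ≤ y) :
    fixedValue ε L (Real.exp (ε * y)) = 0 := by
  induction L generalizing y with
  | nil =>
    simp only [List.sum_nil] at hy
    exact max_eq_right (sub_nonpos.2 (Real.one_le_exp (by positivity)))
  | cons t L ih =>
    simp only [List.sum_cons] at hy
    have hL' : ∀ u ∈ L, u ∈ Set.Icc (0 : ℝ) 1 := fun u hu => hL u (by simp [hu])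
    simp only [fixedValue, stepAvg, exp_down, exp_up]
    rw [ih hL' (by linarith), ih hL' (by linarith)]
    ring

theorem FixedOptimal.lt_sum {ε : ℝ} (hε : 0 < ε) {L : List ℝ} {y : ℝ}
    (h : FixedOptimal ε L y) (hy : y < L.length) : y < L.sum := by
  by_contra hle
  have := fixedValue_eq_zero hε h.1 (not_lt.1 hle)
  linarith [optValue_pos hε L.length hy, h.2]

/-! ### Uniqueness of the optimal last step -/

theorem payoff_exp_of_nonneg {ε z : ℝ} (hε : 0 < ε) (hz : 0 ≤ z) :
    max (1 - Real.exp (ε * z)) 0 = 0 :=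
  max_eq_right (sub_nonpos.2 (Real.one_le_exp (mul_nonneg hε.le hz)))

theorem payoff_exp_of_nonpos {ε z : ℝ} (hε : 0 < ε) (hz : z ≤ 0) :
    max (1 - Real.exp (ε * z)) 0 = 1 - Real.exp (ε * z) :=
  max_eq_left (sub_nonneg.2 (Real.exp_le_one_iff.2 (mul_nonpos_of_nonneg_of_nonpos hε.le hz)))

theorem downProb_mul (ε : ℝ) (hε : 0 < ε) (t : ℝ) :
    downProb ε t * (1 - Real.exp (-ε)) = 1 - Real.exp (ε * (t - 1)) :=
  div_mul_cancel₀ _ (one_sub_exp_neg_pos hε).ne'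

/-- The value of the optimal step with one round left. -/
theorem sq_le_optValue_one {ε : ℝ} (hε : 0 < ε) {y : ℝ} (h1 : -1 < y) (h2 : y < 1) :
    (1 - Real.exp (ε * (y - 1) / 2)) ^ 2 ≤
      (1 - Real.exp (-ε)) * optValue ε 1 (Real.exp (ε * y)) := by
  -- If the up-state pays nothing, the value is proportional to `(1 - e^(ε (t - 1))) (1 - e^(ε (y -
  -- t)))`. The two exponentials have a product independent of `t`, so equalizing them is best: `t -
  -- 1 = y - t`.
  have hu : (1 + y) / 2 ∈ Set.Icc (0 : ℝ) 1 := ⟨by linarith, by linarith⟩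
  have hle : _ ≤ optValue ε 1 (Real.exp (ε * y)) := stepAvg_le_optValue hε 0 hu _
  have hval : stepAvg ε ((1 + y) / 2) (optValue ε 0) (Real.exp (ε * y)) =
      downProb ε ((1 + y) / 2) * (1 - Real.exp (ε * (y - (1 + y) / 2))) := by
    simp only [optValue, stepAvg, exp_down, exp_up]
    rw [payoff_exp_of_nonneg hε (show 0 ≤ y + 1 - (1 + y) / 2 by linarith),
      payoff_exp_of_nonpos hε (show y - (1 + y) / 2 ≤ 0 by linarith), mul_zero, add_zero]
  rw [hval] at hle
  refine le_trans (le_of_eq ?_) (mul_le_mul_of_nonneg_left hle (one_sub_exp_neg_pos hε).le)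
  have hp := downProb_mul ε hε ((1 + y) / 2)
  rw [show ε * ((1 + y) / 2 - 1) = ε * (y - 1) / 2 by ring] at hp
  rw [show ε * (y - (1 + y) / 2) = ε * (y - 1) / 2 by ring]
  linear_combination (-(1 - Real.exp (ε * (y - 1) / 2))) * hp

/-- With one round left, the optimal step from a state strictly between `e^(-ε)` and `e^ε` is
unique. -/
theorem FixedOptimal.eq_of_singleton {ε : ℝ} (hε : 0 < ε) {t y : ℝ}
    (h : FixedOptimal ε [t] y) (h1 : -1 < y) (h2 : y < 1) : t = (1 + y) / 2 := by
  have hc : y < t := by simpa using h.lt_sum hε (by simpa using h2)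
  have hle := (sq_le_optValue_one hε h1 h2).trans
    (mul_le_mul_of_nonneg_left h.2 (one_sub_exp_neg_pos hε).le)
  simp only [fixedValue, stepAvg, exp_down, exp_up] at hle
  rw [payoff_exp_of_nonpos hε (show y - t ≤ 0 by linarith)] at hle
  rcases le_or_gt 0 (y + 1 - t) with hc' | hc'
  · rw [payoff_exp_of_nonneg hε hc', mul_zero, add_zero, ← mul_assoc,
      mul_comm (1 - Real.exp (-ε)), downProb_mul ε hε] at hle
    -- With `q` the common exponential at the optimal step and `r` the deviation factor of `t`,
    -- optimality says `(1 - q)² ≤ (1 - q r) (1 - q / r)`, that is `q (r - 1)² ≤ 0`.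
    have e1 : Real.exp (ε * (t - 1)) =
        Real.exp (ε * (y - 1) / 2) * Real.exp (ε * (t - (1 + y) / 2)) := by
      rw [← Real.exp_add]; ring_nf
    have e2 : Real.exp (ε * (y - t)) * Real.exp (ε * (t - (1 + y) / 2)) =
        Real.exp (ε * (y - 1) / 2) := by
      rw [← Real.exp_add]; ring_nf
    have hq := Real.exp_pos (ε * (y - 1) / 2)
    have hr := Real.exp_pos (ε * (t - (1 + y) / 2))
    rw [e1] at hle
    have hr1 : Real.exp (ε * (t - (1 + y) / 2)) = 1 := by
      generalize Real.exp (ε * (y - 1) / 2) = q at *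
      generalize Real.exp (ε * (t - (1 + y) / 2)) = r at *
      generalize Real.exp (ε * (y - t)) = z at *
      have h3 := mul_le_mul_of_nonneg_right hle hr.le
      have h4 : (1 - q * r) * (1 - z) * r = (1 - q * r) * (r - q) := by
        rw [← e2]; ring
      rw [h4] at h3
      have h5 : q * (r - 1) ^ 2 ≤ 0 := by linarith
      have h6 : (r - 1) ^ 2 = 0 :=
        le_antisymm (nonpos_of_mul_nonpos_right h5 hq) (sq_nonneg _)
      linarith [pow_eq_zero_iff two_ne_zero |>.1 h6]
    rw [Real.exp_eq_one_iff] at hr1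
    rcases mul_eq_zero.1 hr1 with h | h <;> linarith
  · exfalso
    -- Here both end states lie where the payoff is linear, so the step gains nothing over `1 - e^(ε
    -- y)`.
    have hmean := downProb_mean hε t
    have hlin : downProb ε t * (1 - Real.exp (ε * (y - t))) +
        (1 - downProb ε t) * (1 - Real.exp (ε * (y + 1 - t))) = 1 - Real.exp (ε * y) := by
      rw [← exp_down, ← exp_up]
      linear_combination (-Real.exp (ε * y)) * hmean
    rw [payoff_exp_of_nonpos hε hc'.le, hlin] at hle
    have e1 : Real.exp (-ε) = Real.exp (-ε / 2) ^ 2 := by rw [sq, ← Real.exp_add]; ring_nf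
    have e2 : Real.exp (ε * y) = Real.exp (ε * y / 2) ^ 2 := by rw [sq, ← Real.exp_add]; ring_nf
    have e3 : Real.exp (ε * (y - 1) / 2) = Real.exp (-ε / 2) * Real.exp (ε * y / 2) := by
      rw [← Real.exp_add]; ring_nf
    have hne : Real.exp (-ε / 2) < Real.exp (ε * y / 2) :=
      Real.exp_lt_exp.2 (by linarith [mul_pos hε (show 0 < y + 1 by linarith)])
    rw [e1, e2, e3] at hle
    generalize Real.exp (-ε / 2) = a at *
    generalize Real.exp (ε * y / 2) = b at *
    -- The contradiction is the identity `(1 - a b)² - (1 - a²) (1 - b²) = (b - a)²`.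
    have := pow_pos (sub_pos.2 hne) 2
    linarith

/-! ### Rigidity of optimal fixed strategies -/

theorem List.sum_le_length {L : List ℝ} (hL : ∀ t ∈ L, t ∈ Set.Icc (0 : ℝ) 1) :
    L.sum ≤ L.length := by
  simpa using List.sum_le_card_nsmul L 1 fun t ht => (hL t ht).2

/-- A step `0` or `1` does not move the state, so it can be played last, after the nondegenerate
steps have led to a state in `(-1, 0]`. There the unique optimal step lies strictly between `0` and
`1`. -/
theorem FixedOptimal.nondegenerate {ε : ℝ} (hε : 0 < ε) {L : List ℝ} {y : ℝ}
    (h : FixedOptimal ε L y) (hy0 : 0 ≤ y) (hy : y < L.length) :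
    ∀ t ∈ L, t ∈ Set.Ioo (0 : ℝ) 1 := by
  intro t ht
  by_contra hdeg
  have htI := h.1 t ht
  have ht01 : t = 0 ∨ t = 1 := by
    rcases htI.1.eq_or_lt with h0 | h0
    · exact Or.inl h0.symm
    · rcases htI.2.eq_or_lt with h1 | h1
      · exact Or.inr h1
      · exact absurd ⟨h0, h1⟩ hdeg
  classical
  let T := (L.erase t).filter fun u => u = 0 ∨ u = 1
  let N := (L.erase t).filter fun u => ¬ (u = 0 ∨ u = 1)
  have hTN : (T ++ N).Perm (L.erase t) := by
    have := List.filter_append_perm (fun u : ℝ => decide (u = 0 ∨ u = 1)) (L.erase t)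
    simpa [T, N] using this
  have hT : ∀ u ∈ T, u = 0 ∨ u = 1 := fun u hu => by simpa using (List.mem_filter.1 hu).2
  have hNI : ∀ u ∈ N, u ∈ Set.Icc (0 : ℝ) 1 := fun u hu =>
    h.1 u (List.mem_of_mem_erase (List.mem_filter.1 hu).1)
  have hN : ∀ u ∈ N, u ∈ Set.Ioo (0 : ℝ) 1 := fun u hu => by
    have h1 := hNI u hu
    have h2 : ¬ (u = 0 ∨ u = 1) := by simpa using (List.mem_filter.1 hu).2
    push Not at h2
    exact ⟨lt_of_le_of_ne h1.1 h2.1.symm, lt_of_le_of_ne h1.2 h2.2⟩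
  have hperm : L.Perm (T ++ (N ++ [t])) := by
    refine (List.perm_cons_erase ht).trans ?_
    rw [← List.append_assoc]
    exact (hTN.symm.cons t).trans (List.perm_append_singleton t (T ++ N)).symm
  have hopt := (h.perm hperm).of_degenerate_append hε hT
  have hval : fixedValue ε L = fixedValue ε N := by
    rw [fixedValue_perm ε hperm, fixedValue_degenerate_append hε _ hT,
      fixedValue_perm ε (List.perm_append_singleton t N)]
    exact fixedValue_degenerate_append hε (L := [t]) N (by simpa using ht01)
  have hsum : y < N.sum := by
    by_contra hle
    have h0 := fixedValue_eq_zero hε hNI (not_lt.1 hle)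
    have := optValue_pos hε _ hy
    rw [← hval] at h0
    linarith [h.2]
  have hlen := List.sum_le_length hNI
  -- With this number of up-steps the walk through `N` ends in `(-1, 0]`.
  have hj1 := Nat.floor_le (show 0 ≤ N.sum - y by linarith)
  have hj2 := Nat.lt_floor_add_one (N.sum - y)
  have hj : ⌊N.sum - y⌋₊ ≤ N.length := by
    have : (⌊N.sum - y⌋₊ : ℝ) ≤ N.length := by linarith
    exact_mod_cast this
  have := (hopt.walk hε hN hj).eq_of_singleton hε (by linarith) (by linarith)
  rcases ht01 with h0 | h0 <;> linarith

/-- The step `t` is played last. If `(L.erase t).sum - y` is not an integer, its floor and the next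
integer, as numbers of up-steps, lead to two states in `(-1, 1)` that require different values of
`t`. -/
theorem FixedOptimal.eq_half {ε : ℝ} (hε : 0 < ε) {L : List ℝ} {y : ℝ}
    (h : FixedOptimal ε L y) (hy0 : 0 ≤ y) (hy : y ≤ (L.length : ℝ) - 3) {t : ℝ} (ht : t ∈ L) :
    t = 1 / 2 ∧ ∃ j : ℕ, (L.erase t).sum - y = j := by
  have hnd := h.nondegenerate hε hy0 (by linarith)
  have ht01 := hnd t ht
  have hE : ∀ u ∈ L.erase t, u ∈ Set.Ioo (0 : ℝ) 1 := fun u hu => hnd u (List.mem_of_mem_erase hu)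
  have hlen : (L.erase t).length + 1 = L.length := by
    simpa using (List.perm_cons_erase ht).length_eq.symm
  have hlen' : ((L.erase t).length : ℝ) + 1 = L.length := by exact_mod_cast hlen
  have hup := (h.perm (List.perm_cons_erase ht)).up hε ht01.1
  -- Positivity of the value after an up-step with `t` gives `(L.erase t).sum - y > 1 - t > 0`, so
  -- the floor below counts up-steps.
  have hsum := hup.lt_sum hε (by linarith [ht01.1])
  have hsum' := List.sum_le_length fun u hu => Set.Ioo_subset_Icc_self (hE u hu)
  have hlast : FixedOptimal ε (L.erase t ++ [t]) y :=
    h.perm ((List.perm_cons_erase ht).trans (List.perm_append_singleton t _).symm)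
  have hj1 := Nat.floor_le (show 0 ≤ (L.erase t).sum - y by linarith [ht01.2])
  have hj2 := Nat.lt_floor_add_one ((L.erase t).sum - y)
  set j := ⌊(L.erase t).sum - y⌋₊
  have hjl : j ≤ (L.erase t).length := by
    have : (j : ℝ) ≤ (L.erase t).length := by linarith
    exact_mod_cast this
  have e1 := (hlast.walk hε hE hjl).eq_of_singleton hε (by linarith) (by linarith)
  rcases hj1.eq_or_lt with heq | hlt
  · exact ⟨by linarith, j, heq.symm⟩
  · exfalso
    have hjl' : j + 1 ≤ (L.erase t).length := by
      have : (j : ℝ) < (L.erase t).length := by linarith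
      exact_mod_cast this
    have e2 := (hlast.walk hε hE hjl').eq_of_singleton hε (by push_cast; linarith)
      (by push_cast; linarith)
    push_cast at e2
    linarith

theorem not_fixedOptimal {ε : ℝ} (hε : 0 < ε) {L : List ℝ} {y : ℝ} (hL : 4 ≤ L.length)
    (hy0 : 0 ≤ y) (hy : y ≤ (L.length : ℝ) - 3) : ¬ FixedOptimal ε L y := by
  intro h
  obtain ⟨n, hn⟩ : ∃ n, L.length = n + 2 := ⟨L.length - 2, by omega⟩
  obtain rfl : L = List.replicate (n + 2) (1 / 2 : ℝ) :=
    List.eq_replicate_iff.2 ⟨hn, fun t ht => (h.eq_half hε hy0 hy ht).1⟩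
  obtain ⟨-, j, hj⟩ := h.eq_half hε hy0 hy (t := 1 / 2) (by simp)
  simp only [List.length_replicate] at hL hy
  have hj' : ((n : ℝ) + 1) * (1 / 2) - y = j := by
    rw [← hj, List.replicate_succ, List.erase_cons_head, List.sum_replicate, nsmul_eq_mul]
    push_cast; rfl
  have hjn : j + 1 ≤ n := by
    have : (2 * j : ℝ) ≤ n + 1 := by linarith
    have : 2 * j ≤ n + 1 := by exact_mod_cast this
    omega
  have h' : FixedOptimal ε (List.replicate n (1 / 2 : ℝ) ++ List.replicate 2 (1 / 2 : ℝ)) y := by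
    rwa [← List.replicate_add]
  -- One up-step more than the balanced number `j` leads to the state `3/2`; two half-steps remain,
  -- with sum `1 < 3/2 < 2`.
  have := (h'.walk hε (fun t ht => by rw [List.eq_of_mem_replicate ht]; norm_num)
    (j := j + 1) (by simpa using hjn))
  simp only [List.sum_replicate, nsmul_eq_mul] at this
  have := this.lt_sum hε (by push_cast; simp; linarith)
  simp only [List.sum_replicate, nsmul_eq_mul] at this
  push_cast at this
  linarith

/-- In the range `0 ≤ y ≤ k - 3`, adaptivity strictly improves on every fixed strategy. -/
theorem fixedValue_lt_optValue {ε : ℝ} (hε : 0 < ε) {L : List ℝ} {y : ℝ} (hL : 4 ≤ L.length)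
    (hL' : ∀ t ∈ L, t ∈ Set.Icc (0 : ℝ) 1) (hy0 : 0 ≤ y) (hy : y ≤ (L.length : ℝ) - 3) :
    fixedValue ε L (Real.exp (ε * y)) < optValue ε L.length (Real.exp (ε * y)) :=
  not_le.1 fun h => not_fixedOptimal hε hL hy0 hy ⟨hL', h⟩

/-! ### The optimal `δ` of a mechanism and of a class -/

theorem isDP_one {X : Type u} (nbr : X → X → Prop) (M : Mechanism.{u, v} X) (ε : ℝ) :
    IsDP nbr M ε 1 := by
  intro x x' _ S _
  have h1 : (M.law x : Measure M.Out).real S ≤ 1 := measureReal_le_one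
  have h2 : 0 ≤ Real.exp ε * (M.law x' : Measure M.Out).real S :=
    mul_nonneg (Real.exp_pos _).le measureReal_nonneg
  linarith

theorem deltaOpt_le {X : Type u} {nbr : X → X → Prop} (hne : ∃ x x', nbr x x')
    {M : Mechanism.{u, v} X} {ε δ : ℝ} (h : IsDP nbr M ε δ) : deltaOpt nbr M ε ≤ δ := by
  obtain ⟨x, x', hx⟩ := hne
  refine csInf_le ⟨0, fun δ' hδ' => ?_⟩ h
  simpa using hδ' x x' hx ∅ MeasurableSet.empty

theorem le_deltaOpt {X : Type u} {nbr : X → X → Prop} {M : Mechanism.{u, v} X} {ε δ : ℝ}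
    {x x' : X} (hx : nbr x x') {S : Set M.Out} (hS : MeasurableSet S)
    (h : δ ≤ (M.law x : Measure M.Out).real S -
      Real.exp ε * (M.law x' : Measure M.Out).real S) : δ ≤ deltaOpt nbr M ε := by
  refine le_csInf ⟨1, isDP_one nbr M ε⟩ fun δ' hδ' => ?_
  linarith [hδ' x x' hx S hS]

theorem deltaOpt_le_deltaOptClass {X : Type u} {nbr : X → X → Prop} (hne : ∃ x x', nbr x x')
    {C : Set (Mechanism.{u, v} X)} {M : Mechanism.{u, v} X} (hM : M ∈ C) (ε : ℝ) :
    deltaOpt nbr M ε ≤ deltaOptClass nbr C ε := by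
  refine le_csSup ⟨1, ?_⟩ (Set.mem_image_of_mem _ hM)
  rintro _ ⟨N, -, rfl⟩
  exact deltaOpt_le hne (isDP_one nbr N ε)

theorem deltaOptClass_le {X : Type u} {nbr : X → X → Prop} (hne : ∃ x x', nbr x x')
    {C : Set (Mechanism.{u, v} X)} {ε δ : ℝ} (hδ : 0 ≤ δ) (h : ∀ M ∈ C, IsDP nbr M ε δ) :
    deltaOptClass nbr C ε ≤ δ := by
  -- Nonnegativity of `δ` covers the empty class, whose real supremum is `0`.
  refine Real.sSup_le ?_ hδ
  rintro _ ⟨M, hM, rfl⟩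
  exact deltaOpt_le hne (h M hM)

/-! ### Likelihood ratios of bounded-range pairs -/

/-- The measure `Q` has density `Z` with respect to `P`, with values in
`[e^(-ε t), e^(ε (1 - t))]`. -/
structure HasBoundedRatio {Y : Type*} [MeasurableSpace Y] (ε t : ℝ) (P Q : Measure Y)
    (Z : Y → ℝ) : Prop where
  measurable : Measurable Z
  mem_Icc : ∀ y, Z y ∈ Set.Icc (Real.exp (-(ε * t))) (Real.exp (ε * (1 - t)))
  withDensity_eq : Q = P.withDensity fun y => ENNReal.ofReal (Z y)

/-- With `α` the infimum of `q / p` where it makes sense, bounded range puts the ratio in `[α, e^ε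
α]`. Its mean is `1`, hence `α ≤ 1 ≤ e^ε α`, and `t = -log α / ε`. -/
theorem IsBR.exists_hasBoundedRatio {X : Type u} {nbr : X → X → Prop} {ε : ℝ} (hε : 0 < ε)
    {M : Mechanism.{u, v} X} (hM : IsBR nbr ε M) {x x' : X} (hx : nbr x x') :
    ∃ t ∈ Set.Icc (0 : ℝ) 1, ∃ Z : M.Out → ℝ,
      HasBoundedRatio ε t (M.law x : Measure M.Out) (M.law x') Z := by
  obtain ⟨μ, p, q, -, hp, hq, hP, hQ, h⟩ := hM x x' hx
  have hp1 : ∫⁻ y, p y ∂μ = 1 := by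
    have : (M.law x : Measure M.Out) Set.univ = 1 := measure_univ
    rwa [hP, withDensity_apply _ MeasurableSet.univ, setLIntegral_univ] at this
  have hq1 : ∫⁻ y, q y ∂μ = 1 := by
    have : (M.law x' : Measure M.Out) Set.univ = 1 := measure_univ
    rwa [hQ, withDensity_apply _ MeasurableSet.univ, setLIntegral_univ] at this
  have hfin : ∀ᵐ y ∂μ, p y < ⊤ ∧ q y < ⊤ :=
    (ae_lt_top hp (by simp [hp1])).and (ae_lt_top hq (by simp [hq1]))
  have exists_ne : ∀ f : M.Out → ℝ≥0∞, ∫⁻ y, f y ∂μ = 1 →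
      ∃ y, f y ≠ 0 ∧ p y < ⊤ ∧ q y < ⊤ := by
    intro f hf
    by_contra! hcon
    have h0 : f =ᵐ[μ] 0 := by
      filter_upwards [hfin] with y hy
      by_contra hne
      exact absurd hy.2 (not_lt.2 (hcon y hne hy.1))
    rw [lintegral_congr_ae h0] at hf
    simp at hf
  obtain ⟨yp, hyp, hyp1, hyp2⟩ := exists_ne p hp1
  obtain ⟨yq, hyq, -, -⟩ := exists_ne q hq1
  have hzero : ∀ y, p y = 0 ↔ q y = 0 := by
    intro y
    constructor
    · intro h0
      have := h yp y
      rw [h0, zero_mul, mul_zero, nonpos_iff_eq_zero, mul_eq_zero] at this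
      exact this.resolve_left hyp
    · intro h0
      have := h y yq
      rw [h0, mul_zero, mul_zero, nonpos_iff_eq_zero, mul_eq_zero] at this
      exact this.resolve_right hyq
  let G : Set M.Out := {y | p y ≠ 0 ∧ p y < ⊤ ∧ q y < ⊤}
  let r : M.Out → ℝ := fun y => (q y).toReal / (p y).toReal
  have hpG : ∀ y ∈ G, 0 < (p y).toReal := fun y hy => ENNReal.toReal_pos hy.1 hy.2.1.ne
  have hr0 : ∀ y ∈ G, 0 < r y := fun y hy =>
    div_pos (ENNReal.toReal_pos (fun h0 => hy.1 ((hzero y).2 h0)) hy.2.2.ne) (hpG y hy)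
  have hr : ∀ y₁ ∈ G, ∀ y₂ ∈ G, r y₁ ≤ Real.exp ε * r y₂ := by
    intro y₁ h₁ y₂ h₂
    have h3 := ENNReal.toReal_mono (ENNReal.mul_ne_top ENNReal.ofReal_ne_top
      (ENNReal.mul_ne_top h₁.2.1.ne h₂.2.2.ne)) (h y₂ y₁)
    rw [ENNReal.toReal_mul, ENNReal.toReal_mul, ENNReal.toReal_mul,
      ENNReal.toReal_ofReal (Real.exp_pos _).le] at h3
    have p1 := hpG y₁ h₁
    have p2 := hpG y₂ h₂
    simp only [r]
    rw [← mul_div_assoc, div_le_div_iff₀ p1 p2]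
    linarith
  have hG : yp ∈ G := ⟨hyp, hyp1, hyp2⟩
  have hne : (r '' G).Nonempty := ⟨_, Set.mem_image_of_mem r hG⟩
  have hbdd : BddBelow (r '' G) := ⟨0, by rintro _ ⟨y, hy, rfl⟩; exact (hr0 y hy).le⟩
  have hexp := Real.exp_pos ε
  have hrα : ∀ y ∈ G, sInf (r '' G) ≤ r y := fun y hy => csInf_le hbdd (Set.mem_image_of_mem r hy)
  have hαr : ∀ y ∈ G, r y / Real.exp ε ≤ sInf (r '' G) := by
    intro y hy
    refine le_csInf hne ?_
    rintro _ ⟨y', hy', rfl⟩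
    rw [div_le_iff₀' hexp]
    exact hr y hy y' hy'
  have hα0 : 0 < sInf (r '' G) := (div_pos (hr0 yp hG) hexp).trans_le (hαr yp hG)
  set α := sInf (r '' G)
  have hαβ : α ≤ Real.exp ε * α := by
    have := Real.one_le_exp hε.le
    nlinarith
  -- Clamping changes the ratio only outside `G`, a set that is `P`-null for the first law `P`, and
  -- makes the bounds hold at every outcome.
  let Z : M.Out → ℝ := fun y => max α (min (r y) (Real.exp ε * α))
  have hZm : Measurable Z :=
    measurable_const.max ((hq.ennreal_toReal.div hp.ennreal_toReal).min measurable_const)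
  have hZ : ∀ y, α ≤ Z y ∧ Z y ≤ Real.exp ε * α := fun y =>
    ⟨le_max_left _ _, max_le hαβ (min_le_right _ _)⟩
  have hZr : ∀ y ∈ G, Z y = r y := by
    intro y hy
    have h1 := hαr y hy
    rw [div_le_iff₀' hexp] at h1
    simp only [Z]
    rw [min_eq_left h1, max_eq_right (hrα y hy)]
  have hQZ : (M.law x' : Measure M.Out) =
      (M.law x : Measure M.Out).withDensity fun y => ENNReal.ofReal (Z y) := by
    rw [hP, hQ, ← withDensity_mul μ hp hZm.ennreal_ofReal]
    refine withDensity_congr_ae ?_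
    filter_upwards [hfin] with y hy
    by_cases h0 : p y = 0
    · simp [h0, (hzero y).1 h0]
    · have hy' : y ∈ G := ⟨h0, hy⟩
      rw [Pi.mul_apply, hZr y hy']
      simp only [r]
      rw [ENNReal.ofReal_div_of_pos (hpG y hy'), ENNReal.ofReal_toReal hy.2.ne,
        ENNReal.ofReal_toReal hy.1.ne, ENNReal.mul_div_cancel h0 hy.1.ne]
  have hmean : ∫⁻ y, ENNReal.ofReal (Z y) ∂(M.law x : Measure M.Out) = 1 := by
    have : (M.law x' : Measure M.Out) Set.univ = 1 := measure_univ
    rwa [hQZ, withDensity_apply _ MeasurableSet.univ, setLIntegral_univ] at this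
  have hα1 : α ≤ 1 := by
    have : ∫⁻ _, ENNReal.ofReal α ∂(M.law x : Measure M.Out) ≤ 1 := by
      rw [← hmean]
      exact lintegral_mono fun y => ENNReal.ofReal_le_ofReal (hZ y).1
    rwa [lintegral_const, measure_univ, mul_one, ENNReal.ofReal_le_one] at this
  have hβ1 : 1 ≤ Real.exp ε * α := by
    have : 1 ≤ ∫⁻ _, ENNReal.ofReal (Real.exp ε * α) ∂(M.law x : Measure M.Out) := by
      rw [← hmean]
      exact lintegral_mono fun y => ENNReal.ofReal_le_ofReal (hZ y).2
    rwa [lintegral_const, measure_univ, mul_one, ENNReal.one_le_ofReal] at this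
  have hε' := hε.ne'
  have hlog : Real.exp (-(ε * (-Real.log α / ε))) = α := by
    rw [mul_div_cancel₀ _ hε', neg_neg, Real.exp_log hα0]
  refine ⟨-Real.log α / ε, ⟨div_nonneg (neg_nonneg.2 (Real.log_nonpos hα0.le hα1)) hε.le, ?_⟩,
    Z, hZm, fun y => ?_, hQZ⟩
  · rw [div_le_one hε]
    have := Real.log_nonneg hβ1
    rw [Real.log_mul hexp.ne' hα0.ne', Real.log_exp] at this
    linarith
  · rw [exp_up_eq, hlog]
    exact hZ y

namespace HasBoundedRatio

variable {Y : Type*} [MeasurableSpace Y] {ε t : ℝ} {P Q : Measure Y} {Z : Y → ℝ}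

theorem pos (h : HasBoundedRatio ε t P Q Z) (y : Y) : 0 < Z y :=
  (Real.exp_pos _).trans_le (h.mem_Icc y).1

theorem integral_eq (h : HasBoundedRatio ε t P Q Z) (f : Y → ℝ) :
    ∫ y, f y ∂Q = ∫ y, Z y * f y ∂P := by
  rw [h.withDensity_eq, integral_withDensity_eq_integral_toReal_smul h.measurable.ennreal_ofReal
    (Filter.Eventually.of_forall fun _ => ENNReal.ofReal_lt_top)]
  exact integral_congr_ae (Filter.Eventually.of_forall fun y => by
    simp [ENNReal.toReal_ofReal (h.pos y).le])

theorem integrable [IsFiniteMeasure P] (h : HasBoundedRatio ε t P Q Z) : Integrable Z P :=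
  Integrable.of_bound h.measurable.aestronglyMeasurable (Real.exp (ε * (1 - t)))
    (Filter.Eventually.of_forall fun y => by
      rw [Real.norm_of_nonneg (h.pos y).le]; exact (h.mem_Icc y).2)

theorem integral_eq_one [IsProbabilityMeasure Q] (h : HasBoundedRatio ε t P Q Z) :
    ∫ y, Z y ∂P = 1 := by
  have := h.integral_eq (fun _ => 1)
  simpa using this.symm

/-- Two-point pairs are extremal for expectations of convex functions of the likelihood ratio. -/
theorem integral_convex_le [IsProbabilityMeasure P] [IsProbabilityMeasure Q] (hε : 0 < ε)
    (h : HasBoundedRatio ε t P Q Z) {φ : ℝ → ℝ} (hφ : ConvexOn ℝ Set.univ φ) (c : ℝ)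
    {f : Y → ℝ} (hf : Integrable f P) (hfφ : ∀ y, f y ≤ φ (c * Z y)) :
    ∫ y, f y ∂P ≤ stepAvg ε t φ c := by
  obtain ⟨A, B, hAB, hch⟩ := hφ.exists_chord hε (t := t) c
  calc ∫ y, f y ∂P ≤ ∫ y, (A + B * Z y) ∂P :=
        integral_mono hf ((integrable_const A).add (h.integrable.const_mul B))
          fun y => (hfφ y).trans (hch _ (h.mem_Icc y))
    _ = stepAvg ε t φ c := by
        rw [integral_add (integrable_const A) (h.integrable.const_mul B), integral_const_mul,
          h.integral_eq_one, integral_const]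
        simp [hAB]

end HasBoundedRatio

/-! ### The upper bound for adaptive games -/

section Round

variable {T Y R : Type*} [MeasurableSpace T] [MeasurableSpace Y] [MeasurableSpace R]

/-- The conditional expectation, given the transcript before a round, of a function of the
transcript after the round. -/
noncomputable def roundExpectation (κ : Kernel T Y) (η : Kernel (T × Y) R)
    (u : (T × Y) × R → ℝ) (h : T) : ℝ :=
  ∫ a, ∫ r, u ((h, a), r) ∂η (h, a) ∂κ h

variable {κ : Kernel T Y} [IsMarkovKernel κ] {η : Kernel (T × Y) R} [IsMarkovKernel η]
  {u : (T × Y) × R → ℝ}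

theorem measurable_coinExpectation (hu : Measurable u) :
    Measurable fun p : T × Y => ∫ r, u (p, r) ∂η p :=
  (StronglyMeasurable.integral_kernel_prod_right' hu.stronglyMeasurable).measurable

theorem measurable_roundExpectation (hu : Measurable u) :
    Measurable (roundExpectation κ η u) :=
  (StronglyMeasurable.integral_kernel_prod_right'
    (measurable_coinExpectation (η := η) hu).stronglyMeasurable).measurable

theorem integral_mem_Icc {Ω : Type*} [MeasurableSpace Ω] (μ : Measure Ω) [IsProbabilityMeasure μ]
    {f : Ω → ℝ} (hf : ∀ ω, f ω ∈ Set.Icc (0 : ℝ) 1) : ∫ ω, f ω ∂μ ∈ Set.Icc (0 : ℝ) 1 := by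
  refine ⟨integral_nonneg fun ω => (hf ω).1, ?_⟩
  have := norm_integral_le_of_norm_le_const (μ := μ) (f := f) (C := 1)
    (Filter.Eventually.of_forall fun ω => by rw [Real.norm_of_nonneg (hf ω).1]; exact (hf ω).2)
  simpa using (le_abs_self _).trans this

theorem integrable_of_mem_Icc {Ω : Type*} [MeasurableSpace Ω] (μ : Measure Ω)
    [IsProbabilityMeasure μ] {f : Ω → ℝ} (hm : Measurable f)
    (hf : ∀ ω, f ω ∈ Set.Icc (0 : ℝ) 1) : Integrable f μ :=
  Integrable.of_bound hm.aestronglyMeasurable 1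
    (Filter.Eventually.of_forall fun ω => by rw [Real.norm_of_nonneg (hf ω).1]; exact (hf ω).2)

theorem roundExpectation_mem_Icc (hu : ∀ p, u p ∈ Set.Icc (0 : ℝ) 1) (h : T) :
    roundExpectation κ η u h ∈ Set.Icc (0 : ℝ) 1 :=
  integral_mem_Icc _ fun _ => integral_mem_Icc _ fun _ => hu _

theorem integral_round (μ : Measure T) [IsProbabilityMeasure μ] (hm : Measurable u)
    (hu : ∀ p, u p ∈ Set.Icc (0 : ℝ) 1) :
    ∫ p, u p ∂((μ ⊗ₘ κ) ⊗ₘ η) = ∫ h, roundExpectation κ η u h ∂μ := by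
  rw [Measure.integral_compProd (integrable_of_mem_Icc _ hm hu),
    Measure.integral_compProd (integrable_of_mem_Icc _ (measurable_coinExpectation hm)
      fun _ => integral_mem_Icc _ fun _ => hu _)]
  rfl

/-- Changing measure from `κ' h` to `κ h` turns the difference into a mean of `u - c Z v`, with the
coin law common to both sides. The hypothesis at the threshold `c Z` bounds the integrand by `φ (c
Z)`; this is why it is assumed for all positive `c`. -/
theorem roundExpectation_sub_le {κ' : Kernel T Y} [IsMarkovKernel κ'] {v : (T × Y) × R → ℝ}
    (hum : Measurable u) (hu : ∀ p, u p ∈ Set.Icc (0 : ℝ) 1)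
    (hvm : Measurable v) (hv : ∀ p, v p ∈ Set.Icc (0 : ℝ) 1)
    {ε t : ℝ} (hε : 0 < ε) {φ : ℝ → ℝ} (hφ : ConvexOn ℝ Set.univ φ)
    (huv : ∀ p, ∀ c : ℝ, 0 < c → u p - c * v p ≤ φ c)
    {h : T} {Z : Y → ℝ} (hZ : HasBoundedRatio ε t (κ h) (κ' h) Z) {c : ℝ} (hc : 0 < c) :
    roundExpectation κ η u h - c * roundExpectation κ' η v h ≤ stepAvg ε t φ c := by
  have hu1 : ∀ a, ∫ r, u ((h, a), r) ∂η (h, a) ∈ Set.Icc (0 : ℝ) 1 :=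
    fun a => integral_mem_Icc _ fun _ => hu _
  have hv1 : ∀ a, ∫ r, v ((h, a), r) ∂η (h, a) ∈ Set.Icc (0 : ℝ) 1 :=
    fun a => integral_mem_Icc _ fun _ => hv _
  have hum1 : Measurable fun a => ∫ r, u ((h, a), r) ∂η (h, a) :=
    (measurable_coinExpectation (η := η) hum).comp measurable_prodMk_left
  have hvm1 : Measurable fun a => ∫ r, v ((h, a), r) ∂η (h, a) :=
    (measurable_coinExpectation (η := η) hvm).comp measurable_prodMk_left
  have hint1 := integrable_of_mem_Icc (κ h) hum1 hu1
  have hint2 : Integrable (fun a => Z a * ∫ r, v ((h, a), r) ∂η (h, a)) (κ h) :=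
    hZ.integrable.mul_bdd (c := 1) hvm1.aestronglyMeasurable
      (Filter.Eventually.of_forall fun a => by
        rw [Real.norm_of_nonneg (hv1 a).1]; exact (hv1 a).2)
  have heq : roundExpectation κ η u h - c * roundExpectation κ' η v h =
      ∫ a, (∫ r, u ((h, a), r) ∂η (h, a) - c * (Z a * ∫ r, v ((h, a), r) ∂η (h, a))) ∂κ h := by
    rw [integral_sub hint1 (hint2.const_mul c), integral_const_mul, ← hZ.integral_eq]
    rfl
  rw [heq]
  refine hZ.integral_convex_le hε hφ c (hint1.sub (hint2.const_mul c)) fun a => ?_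
  have hcZ := mul_pos hc (hZ.pos a)
  have hi1 : Integrable (fun r => u ((h, a), r)) (η (h, a)) :=
    integrable_of_mem_Icc _ (hum.comp measurable_prodMk_left) fun _ => hu _
  have hi2 : Integrable (fun r => v ((h, a), r)) (η (h, a)) :=
    integrable_of_mem_Icc _ (hvm.comp measurable_prodMk_left) fun _ => hv _
  rw [← mul_assoc, ← integral_const_mul, ← integral_sub hi1 (hi2.const_mul _)]
  calc _ ≤ ∫ _, φ (c * Z a) ∂η (h, a) :=
        integral_mono (hi1.sub (hi2.const_mul _)) (integrable_const _)
          fun r => huv ((h, a), r) _ hcZ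
    _ = φ (c * Z a) := by simp

end Round

namespace Adversary

variable {X : Type u} {nbr : X → X → Prop} {ε : ℝ}

instance {E : ℕ → Set (Mechanism.{u, v} X)} (A : Adversary.{u, v} nbr E) (b : Bool) (i : ℕ) :
    IsProbabilityMeasure (A.view b i) :=
  A.isProbabilityMeasure_view b i

theorem exists_answer_hasBoundedRatio (hsymm : ∀ x x', nbr x x' → nbr x' x) (hε : 0 < ε)
    (A : Adversary.{u, v} nbr fun _ => classBR nbr ε) {b b' : Bool} (hb : b ≠ b') (i : ℕ)
    (h : Transcript A.R A.Y i) :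
    ∃ t ∈ Set.Icc (0 : ℝ) 1, ∃ Z, HasBoundedRatio ε t (A.answer b i h) (A.answer b' i h) Z := by
  have hnbr : nbr (A.data i h b) (A.data i h b') := by
    have h0 := A.data_nbr i h
    cases b <;> cases b'
    exacts [absurd rfl hb, h0, hsymm _ _ h0, absurd rfl hb]
  exact IsBR.exists_hasBoundedRatio hε (A.mech_mem i h) hnbr

/-- Backward induction: `m` rounds are already integrated out and `k` remain. Two test functions are
needed, since integrating out a round under the two bits turns one indicator into two different
functions. -/
theorem integral_view_sub_le (hsymm : ∀ x x', nbr x x' → nbr x' x) (hε : 0 < ε)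
    (A : Adversary.{u, v} nbr fun _ => classBR nbr ε) {b b' : Bool} (hb : b ≠ b') (k m : ℕ)
    {f g : Transcript A.R A.Y k → ℝ}
    (hfm : Measurable f) (hf : ∀ h, f h ∈ Set.Icc (0 : ℝ) 1)
    (hgm : Measurable g) (hg : ∀ h, g h ∈ Set.Icc (0 : ℝ) 1)
    (hfg : ∀ h, ∀ c : ℝ, 0 < c → f h - c * g h ≤ optValue ε m c) {c : ℝ} (hc : 0 < c) :
    ∫ h, f h ∂A.view b k - c * ∫ h, g h ∂A.view b' k ≤ optValue ε (m + k) c := by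
  induction k generalizing m with
  | zero =>
    have h1 := integrable_of_mem_Icc (A.view b 0) hfm hf
    have h2 := integrable_of_mem_Icc (A.view b 0) hgm hg
    change ∫ h, f h ∂A.view b 0 - c * ∫ h, g h ∂A.view b 0 ≤ _
    rw [← integral_const_mul, ← integral_sub h1 (h2.const_mul c)]
    calc _ ≤ ∫ _, optValue ε m c ∂A.view b 0 :=
          integral_mono (h1.sub (h2.const_mul c)) (integrable_const _) fun h => hfg h c hc
      _ = optValue ε (m + 0) c := by simp
  | succ k ih =>
    have e1 : ∫ h, f h ∂A.view b (k + 1) =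
        ∫ h, roundExpectation (A.answer b k) (A.coin k) f h ∂A.view b k :=
      integral_round (A.view b k) hfm hf
    have e2 : ∫ h, g h ∂A.view b' (k + 1) =
        ∫ h, roundExpectation (A.answer b' k) (A.coin k) g h ∂A.view b' k :=
      integral_round (A.view b' k) hgm hg
    rw [e1, e2, show m + (k + 1) = m + 1 + k by ring]
    refine ih (m + 1) (measurable_roundExpectation hfm) (roundExpectation_mem_Icc hf)
      (measurable_roundExpectation hgm) (roundExpectation_mem_Icc hg) fun h c' hc' => ?_
    obtain ⟨t, ht, Z, hZ⟩ := A.exists_answer_hasBoundedRatio hsymm hε hb k h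
    exact (roundExpectation_sub_le hfm hf hgm hg hε (convexOn_optValue hε m) hfg hZ hc').trans
      (stepAvg_le_optValue hε m ht c')

theorem view_real_sub_le (hsymm : ∀ x x', nbr x x' → nbr x' x) (hε : 0 < ε)
    (A : Adversary.{u, v} nbr fun _ => classBR nbr ε) {b b' : Bool} (hb : b ≠ b') (k : ℕ)
    {c : ℝ} (hc : 0 < c) {S : Set (Transcript A.R A.Y k)} (hS : MeasurableSet S) :
    (A.view b k).real S - c * (A.view b' k).real S ≤ optValue ε k c := by
  have hm : Measurable (S.indicator fun _ => (1 : ℝ)) := measurable_const.indicator hS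
  have hI : ∀ h, S.indicator (fun _ => (1 : ℝ)) h ∈ Set.Icc (0 : ℝ) 1 := fun h =>
    ⟨Set.indicator_nonneg (fun _ _ => zero_le_one) h,
      Set.indicator_le_self' (fun _ _ => zero_le_one) h⟩
  have := A.integral_view_sub_le hsymm hε hb k 0 hm hI hm hI (fun h c hc => ?_) hc
  · rw [integral_indicator_const _ hS, integral_indicator_const _ hS, zero_add] at this
    simpa only [smul_eq_mul, mul_one] using this
  · by_cases hmem : h ∈ S
    · rw [Set.indicator_of_mem hmem]
      exact le_trans (by linarith) (le_max_left _ _)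
    · rw [Set.indicator_of_notMem hmem]
      exact le_trans (by simp) (le_max_right _ _)

theorem isDP_game (hsymm : ∀ x x', nbr x x' → nbr x' x) (hε : 0 < ε)
    (A : Adversary.{u, v} nbr fun _ => classBR nbr ε) (k : ℕ) (εg : ℝ) :
    IsDP (fun b b' : Bool => b ≠ b') (A.game k) εg (optValue ε k (Real.exp εg)) := by
  intro b b' hb S hS
  have := A.view_real_sub_le hsymm hε hb k (Real.exp_pos εg) (S := S) hS
  change (A.view b k).real S ≤ _ * (A.view b' k).real S + _
  linarith

end Adversary

theorem deltaAdaptive_le {X : Type u} {nbr : X → X → Prop}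
    (hsymm : ∀ x x', nbr x x' → nbr x' x) {ε : ℝ} (hε : 0 < ε) (k : ℕ) (εg : ℝ) :
    deltaAdaptive.{u, v} nbr ε k εg ≤ optValue ε k (Real.exp εg) := by
  refine deltaOptClass_le ⟨false, true, by simp⟩ (optValue_nonneg hε k _) ?_
  rintro _ ⟨A, rfl⟩
  exact A.isDP_game hsymm hε k εg

/-! ### Products of bounded-range pairs -/

theorem real_withDensity_ofReal {Y : Type*} [MeasurableSpace Y] {P : Measure Y} {W : Y → ℝ}
    (hW : Integrable W P) (hW0 : ∀ y, 0 ≤ W y) {S : Set Y} (hS : MeasurableSet S) :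
    (P.withDensity fun y => ENNReal.ofReal (W y)).real S = ∫ y in S, W y ∂P := by
  rw [measureReal_def, withDensity_apply _ hS,
    integral_eq_lintegral_of_nonneg_ae (Filter.Eventually.of_forall hW0)
      hW.aestronglyMeasurable.restrict]

theorem real_sub_eq_setIntegral {Y : Type*} [MeasurableSpace Y] {P : Measure Y}
    [IsProbabilityMeasure P] {W : Y → ℝ} (hW : Integrable W P) (hW0 : ∀ y, 0 ≤ W y) (c : ℝ)
    {S : Set Y} (hS : MeasurableSet S) :
    P.real S - c * (P.withDensity fun y => ENNReal.ofReal (W y)).real S =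
      ∫ y in S, (1 - c * W y) ∂P := by
  rw [real_withDensity_ofReal hW hW0 hS,
    integral_sub (integrable_const _) (hW.const_mul c).integrableOn, integral_const_mul]
  simp

theorem integrable_payoff {Y : Type*} [MeasurableSpace Y] {P : Measure Y}
    [IsProbabilityMeasure P] {W : Y → ℝ} (hW : Integrable W P) (c : ℝ) :
    Integrable (fun y => max (1 - c * W y) 0) P :=
  ((integrable_const (1 : ℝ)).sub (hW.const_mul c)).pos_part

theorem real_sub_le_integral {Y : Type*} [MeasurableSpace Y] {P : Measure Y}
    [IsProbabilityMeasure P] {W : Y → ℝ} (hW : Integrable W P) (hW0 : ∀ y, 0 ≤ W y) (c : ℝ)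
    {S : Set Y} (hS : MeasurableSet S) :
    P.real S - c * (P.withDensity fun y => ENNReal.ofReal (W y)).real S ≤
      ∫ y, max (1 - c * W y) 0 ∂P := by
  rw [real_sub_eq_setIntegral hW hW0 c hS]
  calc _ ≤ ∫ y in S, max (1 - c * W y) 0 ∂P :=
        integral_mono ((integrable_const (1 : ℝ)).sub (hW.const_mul c).integrableOn)
          (integrable_payoff hW c).integrableOn fun y => le_max_left _ _
    _ ≤ _ := setIntegral_le_integral (integrable_payoff hW c)
        (Filter.Eventually.of_forall fun y => le_max_right _ _)

theorem real_sub_eq_integral {Y : Type*} [MeasurableSpace Y] {P : Measure Y}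
    [IsProbabilityMeasure P] {W : Y → ℝ} (hm : Measurable W) (hW : Integrable W P)
    (hW0 : ∀ y, 0 ≤ W y) (c : ℝ) :
    P.real {y | c * W y < 1} -
      c * (P.withDensity fun y => ENNReal.ofReal (W y)).real {y | c * W y < 1} =
      ∫ y, max (1 - c * W y) 0 ∂P := by
  have hS : MeasurableSet {y | c * W y < 1} :=
    measurableSet_lt (hm.const_mul c) measurable_const
  rw [real_sub_eq_setIntegral hW hW0 c hS, ← integral_indicator hS]
  congr 1 with y
  by_cases hy : c * W y < 1
  · rw [Set.indicator_of_mem (show y ∈ {y | c * W y < 1} from hy)]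
    exact (max_eq_left (by linarith)).symm
  · rw [Set.indicator_of_notMem (show y ∉ {y | c * W y < 1} from hy)]
    exact (max_eq_right (by linarith)).symm

section Pi

variable {ε : ℝ}

theorem integrable_prod_ratio {k : ℕ} {Y : Fin k → Type*} [∀ i, MeasurableSpace (Y i)]
    {P Q : ∀ i, Measure (Y i)} [∀ i, IsProbabilityMeasure (P i)] {t : Fin k → ℝ}
    {Z : ∀ i, Y i → ℝ} (h : ∀ i, HasBoundedRatio ε (t i) (P i) (Q i) (Z i)) :
    Integrable (fun y : ∀ i, Y i => ∏ i, Z i (y i)) (Measure.pi P) :=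
  Integrable.fintype_prod_dep fun i => (h i).integrable

theorem measurable_prod_ratio {k : ℕ} {Y : Fin k → Type*} [∀ i, MeasurableSpace (Y i)]
    {P Q : ∀ i, Measure (Y i)} {t : Fin k → ℝ}
    {Z : ∀ i, Y i → ℝ} (h : ∀ i, HasBoundedRatio ε (t i) (P i) (Q i) (Z i)) :
    Measurable (fun y : ∀ i, Y i => ∏ i, Z i (y i)) :=
  Finset.measurable_prod _ fun i _ => (h i).measurable.comp (measurable_pi_apply i)

theorem pi_eq_withDensity {k : ℕ} {Y : Fin k → Type*} [∀ i, MeasurableSpace (Y i)]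
    {P Q : ∀ i, Measure (Y i)} [∀ i, IsProbabilityMeasure (P i)]
    [∀ i, IsProbabilityMeasure (Q i)] {t : Fin k → ℝ}
    {Z : ∀ i, Y i → ℝ} (h : ∀ i, HasBoundedRatio ε (t i) (P i) (Q i) (Z i)) :
    Measure.pi Q = (Measure.pi P).withDensity fun y => ENNReal.ofReal (∏ i, Z i (y i)) := by
  refine Measure.pi_eq fun s hs => ?_
  have hZ0 : ∀ y : ∀ i, Y i, 0 ≤ ∏ i, Z i (y i) :=
    fun y => Finset.prod_nonneg fun i _ => ((h i).pos _).le
  have hS : MeasurableSet (Set.univ.pi s) := MeasurableSet.univ_pi hs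
  rw [withDensity_apply _ hS,
    ← ofReal_integral_eq_lintegral_ofReal (integrable_prod_ratio h).integrableOn
      (Filter.Eventually.of_forall hZ0), Measure.restrict_pi_pi,
    integral_fintype_prod_eq_prod, ENNReal.ofReal_prod_of_nonneg]
  · refine Finset.prod_congr rfl fun i _ => ?_
    rw [← real_withDensity_ofReal (h i).integrable (fun y => ((h i).pos y).le) (hs i),
      ← (h i).withDensity_eq, ofReal_measureReal]
  · exact fun i _ => integral_nonneg fun y => ((h i).pos y).le

theorem measurePreserving_finCons {k : ℕ} {Y : Fin (k + 1) → Type*}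
    [∀ i, MeasurableSpace (Y i)] (P : ∀ i, Measure (Y i)) [∀ i, IsProbabilityMeasure (P i)] :
    MeasurePreserving (fun p : Y 0 × (∀ i : Fin k, Y i.succ) => (Fin.cons p.1 p.2 : ∀ i, Y i))
      ((P 0).prod (Measure.pi fun i : Fin k => P i.succ)) (Measure.pi P) := by
  have hm : Measurable fun p : Y 0 × (∀ i : Fin k, Y i.succ) =>
      (Fin.cons p.1 p.2 : ∀ i, Y i) := by
    refine measurable_pi_iff.2 fun i => ?_
    refine Fin.cases ?_ (fun i => ?_) i
    · exact measurable_fst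
    · exact (measurable_pi_apply i).comp measurable_snd
  refine ⟨hm, (Measure.pi_eq fun s hs => ?_).symm⟩
  rw [Measure.map_apply hm (MeasurableSet.univ_pi hs), Fin.prod_univ_succ, ← Measure.pi_pi,
    ← Measure.prod_prod]
  congr 1 with ⟨x, f⟩
  simp [Fin.forall_fin_succ]

/-- The expected payoff of a product of pairs, as an iterated integral. -/
theorem integral_pi_succ {k : ℕ} {Y : Fin (k + 1) → Type*} [∀ i, MeasurableSpace (Y i)]
    {P Q : ∀ i, Measure (Y i)} [∀ i, IsProbabilityMeasure (P i)] {t : Fin (k + 1) → ℝ}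
    {Z : ∀ i, Y i → ℝ} (h : ∀ i, HasBoundedRatio ε (t i) (P i) (Q i) (Z i)) (c : ℝ) :
    Integrable (fun a => ∫ y, max (1 - c * Z 0 a * ∏ i : Fin k, Z i.succ (y i)) 0
        ∂Measure.pi fun i : Fin k => P i.succ) (P 0) ∧
    ∫ y, max (1 - c * ∏ i, Z i (y i)) 0 ∂Measure.pi P =
      ∫ a, ∫ y, max (1 - c * Z 0 a * ∏ i : Fin k, Z i.succ (y i)) 0
        ∂Measure.pi (fun i : Fin k => P i.succ) ∂P 0 := by
  have hmp := measurePreserving_finCons P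
  have hint := integrable_payoff (integrable_prod_ratio h) c
  have hint2 := hmp.integrable_comp_of_integrable hint
  simp only [Function.comp_def, Fin.prod_univ_succ, Fin.cons_succ, Fin.cons_zero,
    ← mul_assoc] at hint2
  refine ⟨hint2.integral_prod_left, ?_⟩
  rw [← integral_prod _ hint2, ← hmp.map_eq,
    integral_map hmp.aemeasurable (hmp.map_eq.symm ▸ hint.aestronglyMeasurable)]
  simp only [Fin.prod_univ_succ, Fin.cons_succ, Fin.cons_zero, ← mul_assoc]

/-- The parameters do not depend on earlier answers, so after conditioning on the first answer the
same list of remaining steps applies, and convexity of its value handles the first factor. -/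
theorem integral_pi_le_fixedValue (hε : 0 < ε) {k : ℕ} {Y : Fin k → Type*}
    [∀ i, MeasurableSpace (Y i)] {P Q : ∀ i, Measure (Y i)} [∀ i, IsProbabilityMeasure (P i)]
    [∀ i, IsProbabilityMeasure (Q i)] {t : Fin k → ℝ} (ht : ∀ i, t i ∈ Set.Icc (0 : ℝ) 1)
    {Z : ∀ i, Y i → ℝ} (h : ∀ i, HasBoundedRatio ε (t i) (P i) (Q i) (Z i)) (c : ℝ) :
    ∫ y, max (1 - c * ∏ i, Z i (y i)) 0 ∂Measure.pi P ≤ fixedValue ε (List.ofFn t) c := by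
  induction k generalizing c with
  | zero => simp [fixedValue]
  | succ k ih =>
    rw [(integral_pi_succ h c).2, List.ofFn_succ]
    refine (h 0).integral_convex_le hε (convexOn_fixedValue hε ?_) c (integral_pi_succ h c).1
      fun a => ih (fun i => ht i.succ) (fun i => h i.succ) _
    intro u hu
    obtain ⟨i, rfl⟩ := (List.mem_ofFn' _ _).1 hu
    exact ht i.succ

theorem integral_pi_eq_fixedValue {k : ℕ} {Y : Fin k → Type*}
    [∀ i, MeasurableSpace (Y i)] {P Q : ∀ i, Measure (Y i)} [∀ i, IsProbabilityMeasure (P i)]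
    {t : Fin k → ℝ}
    {Z : ∀ i, Y i → ℝ} (h : ∀ i, HasBoundedRatio ε (t i) (P i) (Q i) (Z i))
    (htwo : ∀ i, ∀ (φ : ℝ → ℝ) (c : ℝ), ∫ a, φ (c * Z i a) ∂P i = stepAvg ε (t i) φ c) (c : ℝ) :
    ∫ y, max (1 - c * ∏ i, Z i (y i)) 0 ∂Measure.pi P = fixedValue ε (List.ofFn t) c := by
  induction k generalizing c with
  | zero => simp [fixedValue]
  | succ k ih =>
    rw [(integral_pi_succ h c).2, List.ofFn_succ]
    simp only [ih (fun i => h i.succ) fun i => htwo i.succ]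
    exact htwo 0 _ c

end Pi

/-! ### Two-point pairs -/

/-- The law on two outcomes that gives mass `w` to the first one. -/
noncomputable def twoPointLaw (w : ℝ) : Measure (ULift.{v} Bool) :=
  ENNReal.ofReal w • Measure.dirac ⟨false⟩ + ENNReal.ofReal (1 - w) • Measure.dirac ⟨true⟩

theorem isProbabilityMeasure_twoPointLaw {w : ℝ} (hw : w ∈ Set.Icc (0 : ℝ) 1) :
    IsProbabilityMeasure (twoPointLaw.{v} w) := by
  constructor
  simp only [twoPointLaw, Measure.add_apply, Measure.smul_apply, measure_univ, smul_eq_mul,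
    mul_one]
  rw [← ENNReal.ofReal_add hw.1 (sub_nonneg.2 hw.2)]
  simp

theorem integral_twoPointLaw {w : ℝ} (hw : w ∈ Set.Icc (0 : ℝ) 1) (f : ULift.{v} Bool → ℝ) :
    ∫ a, f a ∂twoPointLaw.{v} w = w * f ⟨false⟩ + (1 - w) * f ⟨true⟩ := by
  rw [twoPointLaw, integral_add_measure (Integrable.of_finite.smul_measure ENNReal.ofReal_ne_top)
    (Integrable.of_finite.smul_measure ENNReal.ofReal_ne_top), integral_smul_measure,
    integral_smul_measure, integral_dirac, integral_dirac, ENNReal.toReal_ofReal hw.1,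
    ENNReal.toReal_ofReal (sub_nonneg.2 hw.2)]
  rfl

/-- The likelihood ratio of the extremal pair. -/
noncomputable def twoPointRatio (ε t : ℝ) (a : ULift.{v} Bool) : ℝ :=
  if a.down then Real.exp (ε * (1 - t)) else Real.exp (-(ε * t))

theorem downProb_mem {ε : ℝ} (hε : 0 < ε) {t : ℝ} (ht : t ∈ Set.Icc (0 : ℝ) 1) :
    downProb ε t ∈ Set.Icc (0 : ℝ) 1 :=
  ⟨downProb_nonneg hε ht.2, downProb_le_one hε ht.1⟩

theorem downProb_mul_exp_mem {ε : ℝ} (hε : 0 < ε) {t : ℝ} (ht : t ∈ Set.Icc (0 : ℝ) 1) :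
    downProb ε t * Real.exp (-(ε * t)) ∈ Set.Icc (0 : ℝ) 1 := by
  have h := downProb_mem hε ht
  refine ⟨mul_nonneg h.1 (Real.exp_pos _).le, ?_⟩
  have := mul_nonneg (sub_nonneg.2 h.2) (Real.exp_pos (ε * (1 - t))).le
  linarith [downProb_mean hε t]

theorem twoPoint_hasBoundedRatio {ε : ℝ} (hε : 0 < ε) {t : ℝ} (ht : t ∈ Set.Icc (0 : ℝ) 1) :
    HasBoundedRatio ε t (twoPointLaw.{v} (downProb ε t))
      (twoPointLaw (downProb ε t * Real.exp (-(ε * t)))) (twoPointRatio ε t) := by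
  refine ⟨Measurable.of_discrete, fun a => ?_, ?_⟩
  · have : Real.exp (-(ε * t)) ≤ Real.exp (ε * (1 - t)) := Real.exp_le_exp.2 (by nlinarith)
    unfold twoPointRatio
    split_ifs <;> constructor <;> simp [this]
  · have h := downProb_mem hε ht
    have e : 1 - downProb ε t * Real.exp (-(ε * t)) =
        (1 - downProb ε t) * Real.exp (ε * (1 - t)) := by linarith [downProb_mean hε t]
    ext S hS
    rw [withDensity_apply _ hS, twoPointLaw, twoPointLaw, e, ENNReal.ofReal_mul h.1,
      ENNReal.ofReal_mul (sub_nonneg.2 h.2), ← lintegral_indicator hS,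
      lintegral_add_measure, lintegral_smul_measure, lintegral_smul_measure, lintegral_dirac,
      lintegral_dirac]
    simp only [Measure.add_apply, Measure.smul_apply, smul_eq_mul, Measure.dirac_apply' _ hS,
      twoPointRatio]
    by_cases h0 : (⟨false⟩ : ULift.{v} Bool) ∈ S <;>
      by_cases h1 : (⟨true⟩ : ULift.{v} Bool) ∈ S <;> simp [h0, h1]

theorem integral_twoPointRatio {ε : ℝ} (hε : 0 < ε) {t : ℝ} (ht : t ∈ Set.Icc (0 : ℝ) 1)
    (φ : ℝ → ℝ) (c : ℝ) :
    ∫ a, φ (c * twoPointRatio ε t a) ∂twoPointLaw.{v} (downProb ε t) = stepAvg ε t φ c := by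
  rw [integral_twoPointLaw (downProb_mem hε ht)]
  simp [twoPointRatio, stepAvg]

open Classical in
/-- The mechanism that answers with the first law of the extremal pair on `x₀`, and with the second
one on every other dataset. -/
noncomputable def twoPointMech {X : Type u} (x₀ : X) {ε : ℝ} (hε : 0 < ε) {t : ℝ}
    (ht : t ∈ Set.Icc (0 : ℝ) 1) (x : X) : ProbabilityMeasure (ULift.{v} Bool) :=
  if x = x₀ then ⟨twoPointLaw (downProb ε t),
    isProbabilityMeasure_twoPointLaw (downProb_mem hε ht)⟩
  else ⟨twoPointLaw (downProb ε t * Real.exp (-(ε * t))),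
    isProbabilityMeasure_twoPointLaw (downProb_mul_exp_mem hε ht)⟩

/-- Relative to `P` the only densities are `1` and `Z`. Bounded range holds in both orders because
it depends only on the relative spread of `Z`, which is at most `e^ε`. -/
theorem HasBoundedRatio.isBR {X : Type u} {Y : Type v} [MeasurableSpace Y]
    (nbr : X → X → Prop) {ε t : ℝ} (hε : 0 ≤ ε) {P Q : ProbabilityMeasure Y} {Z : Y → ℝ}
    (h : HasBoundedRatio ε t (P : Measure Y) Q Z) (f : X → ProbabilityMeasure Y)
    (hf : ∀ x, f x = P ∨ f x = Q) : IsBR nbr ε (⟨Y, f⟩ : Mechanism.{u, v} X) := by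
  intro x x' _
  have hdens : ∀ x, ∃ p : Y → ℝ, Measurable p ∧ (p = 1 ∨ p = Z) ∧
      (f x : Measure Y) = (P : Measure Y).withDensity fun y => ENNReal.ofReal (p y) := by
    intro x
    rcases hf x with hx | hx
    · exact ⟨1, measurable_one, Or.inl rfl, by simp [hx]⟩
    · exact ⟨Z, h.measurable, Or.inr rfl, by rw [hx]; exact h.withDensity_eq⟩
  obtain ⟨p, hpm, hp, hpx⟩ := hdens x
  obtain ⟨q, hqm, hq, hqx⟩ := hdens x'
  refine ⟨P, fun y => ENNReal.ofReal (p y), fun y => ENNReal.ofReal (q y),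
    inferInstanceAs (SigmaFinite (P : Measure Y)), hpm.ennreal_ofReal, hqm.ennreal_ofReal, hpx, hqx,
    fun y₁ y₂ => ?_⟩
  have hpos : ∀ g : Y → ℝ, (g = 1 ∨ g = Z) → ∀ y, 0 < g y := by
    rintro g (rfl | rfl) y
    exacts [one_pos, h.pos y]
  have h1 := Real.one_le_exp hε
  have hZ : ∀ y y', Z y ≤ Real.exp ε * Z y' := by
    intro y y'
    calc Z y ≤ Real.exp (ε * (1 - t)) := (h.mem_Icc y).2
      _ = Real.exp ε * Real.exp (-(ε * t)) := exp_up_eq ε t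
      _ ≤ Real.exp ε * Z y' := mul_le_mul_of_nonneg_left (h.mem_Icc y').1 (Real.exp_pos _).le
  rw [← ENNReal.ofReal_mul (hpos p hp _).le, ← ENNReal.ofReal_mul (hpos p hp _).le,
    ← ENNReal.ofReal_mul (Real.exp_pos _).le]
  refine ENNReal.ofReal_le_ofReal ?_
  have hz := mul_pos (h.pos y₁) (h.pos y₂)
  rcases hp with rfl | rfl <;> rcases hq with rfl | rfl
  · simpa using h1
  · simpa using hZ y₂ y₁
  · simpa using hZ y₁ y₂
  · nlinarith

theorem twoPointMech_isBR {X : Type u} (nbr : X → X → Prop) (x₀ : X) {ε : ℝ} (hε : 0 < ε) {t : ℝ}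
    (ht : t ∈ Set.Icc (0 : ℝ) 1) :
    IsBR nbr ε (⟨ULift.{v} Bool, twoPointMech x₀ hε ht⟩ : Mechanism.{u, v} X) :=
  HasBoundedRatio.isBR nbr hε.le
    (P := ⟨_, isProbabilityMeasure_twoPointLaw (downProb_mem hε ht)⟩)
    (Q := ⟨_, isProbabilityMeasure_twoPointLaw (downProb_mul_exp_mem hε ht)⟩)
    (twoPoint_hasBoundedRatio hε ht) _ fun x => by
      by_cases hx : x = x₀
      exacts [Or.inl (if_pos hx), Or.inr (if_neg hx)]

/-! ### The nonadaptive family -/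

theorem deltaNonadaptive_le {X : Type u} {nbr : X → X → Prop} (hne : ∃ x x', nbr x x')
    {ε : ℝ} (hε : 0 < ε) (k : ℕ) (εg : ℝ) {δ : ℝ}
    (h : ∀ L : List ℝ, L.length = k → (∀ t ∈ L, t ∈ Set.Icc (0 : ℝ) 1) →
      fixedValue ε L (Real.exp εg) ≤ δ) :
    deltaNonadaptive.{u, v} nbr ε k εg ≤ δ := by
  have hrep : ∀ t ∈ List.replicate k (0 : ℝ), t ∈ Set.Icc (0 : ℝ) 1 := fun t ht => by
    rw [List.eq_of_mem_replicate ht]; simp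
  refine deltaOptClass_le hne ((fixedValue_nonneg hε hrep _).trans (h _ (by simp) hrep)) ?_
  rintro _ ⟨N, hN, rfl⟩ x x' hx S hS
  choose t ht Z hZ using fun i => IsBR.exists_hasBoundedRatio hε (hN i) hx
  have hle := real_sub_le_integral (integrable_prod_ratio hZ)
    (fun y => Finset.prod_nonneg fun i _ => ((hZ i).pos _).le) (Real.exp εg) hS
  rw [← pi_eq_withDensity hZ] at hle
  have := hle.trans ((integral_pi_le_fixedValue hε ht hZ _).trans (h _ (by simp) fun u hu => by
    obtain ⟨i, rfl⟩ := (List.mem_ofFn' _ _).1 hu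
    exact ht i))
  change (Measure.pi fun i => ((N i).law x : Measure (N i).Out)).real S ≤
    _ * (Measure.pi fun i => ((N i).law x' : Measure (N i).Out)).real S + δ
  linarith

theorem fixedValue_le_deltaNonadaptive {X : Type u} {nbr : X → X → Prop} {x₀ x₁ : X}
    (hx : x₀ ≠ x₁) (hnbr : nbr x₀ x₁) {ε : ℝ} (hε : 0 < ε) {L : List ℝ}
    (hL : ∀ t ∈ L, t ∈ Set.Icc (0 : ℝ) 1) (εg : ℝ) :
    fixedValue ε L (Real.exp εg) ≤ deltaNonadaptive.{u, v} nbr ε L.length εg := by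
  have ht : ∀ i : Fin L.length, L.get i ∈ Set.Icc (0 : ℝ) 1 := fun i => hL _ (List.get_mem _ _)
  let N : Fin L.length → Mechanism.{u, v} X := fun i => ⟨ULift.{v} Bool, twoPointMech x₀ hε (ht i)⟩
  have hmem : Mechanism.prod N ∈ nonadaptiveBR.{u, v} nbr ε L.length :=
    ⟨N, fun i => twoPointMech_isBR nbr x₀ hε (ht i), rfl⟩
  refine le_trans ?_ (deltaOpt_le_deltaOptClass ⟨x₀, x₁, hnbr⟩ hmem εg)
  have hZ : ∀ i, HasBoundedRatio ε (L.get i) ((N i).law x₀ : Measure (ULift.{v} Bool))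
      ((N i).law x₁) (twoPointRatio ε (L.get i)) := by
    intro i
    have h0 : (N i).law x₀ = ⟨twoPointLaw (downProb ε (L.get i)),
        isProbabilityMeasure_twoPointLaw (downProb_mem hε (ht i))⟩ := if_pos rfl
    have h1 : (N i).law x₁ = ⟨twoPointLaw (downProb ε (L.get i) * Real.exp (-(ε * L.get i))),
        isProbabilityMeasure_twoPointLaw (downProb_mul_exp_mem hε (ht i))⟩ := if_neg hx.symm
    rw [h0, h1]
    exact twoPoint_hasBoundedRatio hε (ht i)
  have htwo : ∀ i, ∀ (φ : ℝ → ℝ) (c : ℝ), ∫ a, φ (c * twoPointRatio ε (L.get i) a)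
      ∂((N i).law x₀ : Measure (ULift.{v} Bool)) = stepAvg ε (L.get i) φ c := by
    intro i φ c
    have h0 : (N i).law x₀ = ⟨twoPointLaw (downProb ε (L.get i)),
        isProbabilityMeasure_twoPointLaw (downProb_mem hε (ht i))⟩ := if_pos rfl
    rw [h0]
    exact integral_twoPointRatio hε (ht i) φ c
  have hval := integral_pi_eq_fixedValue hZ htwo (Real.exp εg)
  rw [List.ofFn_get] at hval
  have hm := measurable_prod_ratio hZ
  rw [← hval, ← real_sub_eq_integral hm (integrable_prod_ratio hZ)
    (fun y => Finset.prod_nonneg fun i _ => ((hZ i).pos _).le), ← pi_eq_withDensity hZ]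
  exact le_deltaOpt (M := Mechanism.prod N) hnbr
    (measurableSet_lt (hm.const_mul _) measurable_const) le_rfl

/-! ### An optimal adversary -/

/-- Transcripts with two-valued answers and trivial coins. -/
abbrev BitTranscript (i : ℕ) : Type v :=
  Transcript.{v} (fun _ => PUnit.{v + 1}) (fun _ => ULift.{v} Bool) i

theorem BitTranscript.finite_and_measurableSingletonClass :
    ∀ i, Finite (BitTranscript.{v} i) ∧ MeasurableSingletonClass (BitTranscript.{v} i)
  | 0 => ⟨inferInstanceAs (Finite PUnit.{v + 1}),
      inferInstanceAs (MeasurableSingletonClass PUnit.{v + 1})⟩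
  | i + 1 => by
    obtain ⟨h1, h2⟩ := BitTranscript.finite_and_measurableSingletonClass i
    exact ⟨inferInstanceAs (Finite ((BitTranscript.{v} i × ULift.{v} Bool) × PUnit.{v + 1})),
      inferInstanceAs
        (MeasurableSingletonClass ((BitTranscript.{v} i × ULift.{v} Bool) × PUnit.{v + 1}))⟩

instance (i : ℕ) : Finite (BitTranscript.{v} i) :=
  (BitTranscript.finite_and_measurableSingletonClass i).1

instance (i : ℕ) : MeasurableSingletonClass (BitTranscript.{v} i) :=
  (BitTranscript.finite_and_measurableSingletonClass i).2

/-- An optimal step when `m` further rounds follow. -/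
noncomputable def bestStep {ε : ℝ} (hε : 0 < ε) (m : ℕ) (x : ℝ) : ℝ :=
  (exists_optValue_succ_eq hε m x).choose

theorem bestStep_mem {ε : ℝ} (hε : 0 < ε) (m : ℕ) (x : ℝ) :
    bestStep hε m x ∈ Set.Icc (0 : ℝ) 1 :=
  (exists_optValue_succ_eq hε m x).choose_spec.1

theorem stepAvg_bestStep {ε : ℝ} (hε : 0 < ε) (m : ℕ) (x : ℝ) :
    stepAvg ε (bestStep hε m x) (optValue ε m) x = optValue ε (m + 1) x :=
  (exists_optValue_succ_eq hε m x).choose_spec.2.symm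

/-- The likelihood ratio of a transcript, multiplied by `c`, under optimal play of `k` rounds. -/
noncomputable def optimalRatio {ε : ℝ} (hε : 0 < ε) (k : ℕ) (c : ℝ) :
    ∀ i, BitTranscript.{v} i → ℝ
  | 0, _ => c
  | i + 1, ((h, a), _) => optimalRatio hε k c i h *
      twoPointRatio ε (bestStep hε (k - 1 - i) (optimalRatio hε k c i h)) a

/-- The adversary that follows an optimal strategy for `k` rounds. -/
noncomputable def optimalAdversary {X : Type u} {nbr : X → X → Prop} {x₀ x₁ : X}
    (hnbr : nbr x₀ x₁) {ε : ℝ} (hε : 0 < ε) (k : ℕ) (c : ℝ) :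
    Adversary.{u, v} nbr fun _ => classBR nbr ε where
  R _ := PUnit.{v + 1}
  Y _ := ULift.{v} Bool
  init := ⟨Measure.dirac PUnit.unit, inferInstance⟩
  coin _ := Kernel.const _ (Measure.dirac PUnit.unit)
  coin_markov _ := inferInstance
  data _ _ b := if b then x₁ else x₀
  data_nbr _ _ := by simpa using hnbr
  -- After round `i`, `k - 1 - i` rounds remain; the truncation to `0` affects only rounds outside
  -- the `k`-round game.
  mech i h := twoPointMech x₀ hε (bestStep_mem hε (k - 1 - i) (optimalRatio hε k c i h))
  mech_mem i h := twoPointMech_isBR nbr x₀ hε _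
  answer_measurable _ _ := measurable_of_countable _

theorem integral_compProd_const_dirac {T Y R : Type*} [MeasurableSpace T] [MeasurableSpace Y]
    [MeasurableSpace R] [Finite T] [Finite Y] [Finite R] [MeasurableSingletonClass T]
    [MeasurableSingletonClass Y] [MeasurableSingletonClass R] (μ : Measure T)
    [IsProbabilityMeasure μ] (κ : Kernel T Y) [IsMarkovKernel κ] (r : R) (f : (T × Y) × R → ℝ) :
    ∫ p, f p ∂((μ ⊗ₘ κ) ⊗ₘ Kernel.const (T × Y) (Measure.dirac r)) =
      ∫ h, ∫ a, f ((h, a), r) ∂κ h ∂μ := by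
  rw [Measure.integral_compProd Integrable.of_finite]
  simp only [Kernel.const_apply, integral_dirac]
  rw [Measure.integral_compProd Integrable.of_finite]

section OptimalAdversary

variable {X : Type u} {nbr : X → X → Prop} {x₀ x₁ : X} (hnbr : nbr x₀ x₁) {ε : ℝ} (hε : 0 < ε)
  (k : ℕ) (c : ℝ)

/-- The law of the transcript of the optimal adversary. -/
noncomputable def optimalView (b : Bool) (i : ℕ) : Measure (BitTranscript.{v} i) :=
  (optimalAdversary.{u, v} hnbr hε k c).view b i

instance (b : Bool) (i : ℕ) : IsProbabilityMeasure (optimalView.{u, v} hnbr hε k c b i) :=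
  (optimalAdversary.{u, v} hnbr hε k c).isProbabilityMeasure_view b i

/-- The law of the next answer in the game of the optimal adversary. -/
noncomputable def optimalAnswer (b : Bool) (i : ℕ) :
    Kernel (BitTranscript.{v} i) (ULift.{v} Bool) :=
  (optimalAdversary.{u, v} hnbr hε k c).answer b i

instance (b : Bool) (i : ℕ) : IsMarkovKernel (optimalAnswer.{u, v} hnbr hε k c b i) :=
  inferInstanceAs (IsMarkovKernel ((optimalAdversary.{u, v} hnbr hε k c).answer b i))

theorem integral_optimalView_zero (b : Bool) (f : BitTranscript.{v} 0 → ℝ) :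
    ∫ h, f h ∂optimalView.{u, v} hnbr hε k c b 0 = f PUnit.unit :=
  integral_dirac (α := PUnit.{v + 1}) f PUnit.unit

theorem integral_optimalView_false_succ (i : ℕ) (f : BitTranscript.{v} (i + 1) → ℝ) :
    ∫ h, f h ∂optimalView.{u, v} hnbr hε k c false (i + 1) =
      ∫ h, ∫ a, f ((h, a), PUnit.unit)
        ∂twoPointLaw (downProb ε (bestStep hε (k - 1 - i) (optimalRatio hε k c i h)))
        ∂optimalView.{u, v} hnbr hε k c false i := by
  refine (integral_compProd_const_dirac (R := PUnit.{v + 1})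
    (optimalView.{u, v} hnbr hε k c false i) (optimalAnswer.{u, v} hnbr hε k c false i)
    PUnit.unit f).trans ?_
  congr 1 with h
  congr 1
  exact congrArg ProbabilityMeasure.toMeasure (if_pos rfl)

theorem integral_optimalView_true_succ (hx : x₀ ≠ x₁) (i : ℕ)
    (f : BitTranscript.{v} (i + 1) → ℝ) :
    ∫ h, f h ∂optimalView.{u, v} hnbr hε k c true (i + 1) =
      ∫ h, ∫ a, f ((h, a), PUnit.unit)
        ∂twoPointLaw (downProb ε (bestStep hε (k - 1 - i) (optimalRatio hε k c i h)) *
          Real.exp (-(ε * bestStep hε (k - 1 - i) (optimalRatio hε k c i h))))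
        ∂optimalView.{u, v} hnbr hε k c true i := by
  refine (integral_compProd_const_dirac (R := PUnit.{v + 1})
    (optimalView.{u, v} hnbr hε k c true i) (optimalAnswer.{u, v} hnbr hε k c true i)
    PUnit.unit f).trans ?_
  congr 1 with h
  congr 1
  exact congrArg ProbabilityMeasure.toMeasure (if_neg hx.symm)

/-- The ratio tracked by the adversary is `c` times the density of the view for bit `true` with
respect to that for bit `false`. -/
theorem mul_integral_optimalView_true (hx : x₀ ≠ x₁) (i : ℕ) (f : BitTranscript.{v} i → ℝ) :
    c * ∫ h, f h ∂optimalView.{u, v} hnbr hε k c true i =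
      ∫ h, optimalRatio hε k c i h * f h ∂optimalView.{u, v} hnbr hε k c false i := by
  induction i with
  | zero =>
    rw [integral_optimalView_zero, integral_optimalView_zero]
    rfl
  | succ i ih =>
    rw [integral_optimalView_true_succ hnbr hε k c hx, ih, integral_optimalView_false_succ]
    congr 1 with h
    rw [(twoPoint_hasBoundedRatio hε (bestStep_mem hε _ _)).integral_eq, ← integral_const_mul]
    congr 1 with a
    rw [← mul_assoc]
    rfl

/-- Under optimal play the remaining value is a martingale for bit `false`; at `i = k` it is the
payoff. -/
theorem integral_optValue_optimalView (i : ℕ) (hi : i ≤ k) :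
    ∫ h, optValue ε (k - i) (optimalRatio hε k c i h) ∂optimalView.{u, v} hnbr hε k c false i =
      optValue ε k c := by
  induction i with
  | zero =>
    rw [integral_optimalView_zero]
    rfl
  | succ i ih =>
    rw [← ih (by omega), integral_optimalView_false_succ]
    congr 1 with h
    rw [show k - (i + 1) = k - 1 - i by omega, show k - i = k - 1 - i + 1 by omega,
      ← stepAvg_bestStep hε, ← integral_twoPointRatio hε (bestStep_mem hε _ _)]
    rfl

end OptimalAdversary

theorem optValue_le_deltaAdaptive {X : Type u} {nbr : X → X → Prop} {x₀ x₁ : X}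
    (hnbr : nbr x₀ x₁) (hx : x₀ ≠ x₁) {ε : ℝ} (hε : 0 < ε) (k : ℕ) (εg : ℝ) :
    optValue ε k (Real.exp εg) ≤ deltaAdaptive.{u, v} nbr ε k εg := by
  have hmem : (optimalAdversary.{u, v} hnbr hε k (Real.exp εg)).game k ∈
      adaptiveBR.{u, v} nbr ε k := ⟨_, rfl⟩
  refine le_trans ?_ (deltaOpt_le_deltaOptClass ⟨false, true, by simp⟩ hmem εg)
  -- The likelihood-ratio test, on which the payoff is positive.
  let S : Set (BitTranscript.{v} k) := {h | optimalRatio hε k (Real.exp εg) k h < 1}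
  have hS : MeasurableSet S := S.toFinite.measurableSet
  have key : optValue ε k (Real.exp εg) =
      (optimalView.{u, v} hnbr hε k (Real.exp εg) false k).real S -
        Real.exp εg * (optimalView.{u, v} hnbr hε k (Real.exp εg) true k).real S := by
    rw [← integral_optValue_optimalView hnbr hε k (Real.exp εg) k le_rfl, Nat.sub_self,
      ← integral_indicator_one hS, ← integral_indicator_one hS,
      mul_integral_optimalView_true hnbr hε k _ hx,
      ← integral_sub Integrable.of_finite Integrable.of_finite]
    congr 1 with h
    by_cases hh : h ∈ S
    · have : optimalRatio hε k (Real.exp εg) k h < 1 := hh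
      simp only [Set.indicator_of_mem hh, Pi.one_apply, mul_one]
      exact max_eq_left (by linarith)
    · have : ¬ optimalRatio hε k (Real.exp εg) k h < 1 := hh
      simp only [Set.indicator_of_notMem hh, mul_zero, sub_zero]
      exact max_eq_right (by linarith)
  exact le_deltaOpt (M := (optimalAdversary.{u, v} hnbr hε k (Real.exp εg)).game k)
    (x := false) (x' := true) (by simp) (S := S) hS key.le

theorem theorem3p3 {X : Type u} (nbr : X → X → Prop)
    (hsymm : ∀ x x', nbr x x' → nbr x' x) (hne : ∃ x x', x ≠ x' ∧ nbr x x')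
    (ε : ℝ) (hε : 0 < ε) (k : ℕ) (εg : ℝ) :
    (4 ≤ k → 0 ≤ εg → εg ≤ ((k : ℝ) - 3) * ε →
      deltaNonadaptive.{u, v} nbr ε k εg < deltaAdaptive.{u, v} nbr ε k εg) ∧
    (1 ≤ k → ((k : ℝ) - 1) * ε ≤ εg →
      deltaAdaptive.{u, v} nbr ε k εg = deltaNonadaptive.{u, v} nbr ε k εg) := by
  obtain ⟨x₀, x₁, hx, hnbr⟩ := hne
  have hlower := optValue_le_deltaAdaptive.{u, v} hnbr hx hε k εg
  refine ⟨fun hk h0 h1 => ?_, fun _ h1 => le_antisymm ?_ ?_⟩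
  · obtain ⟨L, rfl, hL, hmax⟩ := exists_isMaxOn_fixedValue ε k (Real.exp εg)
    refine (deltaNonadaptive_le ⟨x₀, x₁, hnbr⟩ hε _ εg hmax).trans_lt (lt_of_lt_of_le ?_ hlower)
    -- The exponent of the starting state is `y = εg / ε`.
    have := fixedValue_lt_optValue hε hk hL (div_nonneg h0 hε.le) ((div_le_iff₀ hε).2 h1)
    rwa [mul_div_cancel₀ _ hε.ne'] at this
  · refine (deltaAdaptive_le hsymm hε k εg).trans (optValue_le_of_fixedValue_le hε k
      (Real.exp_le_exp.2 (by linarith)) ?_)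
    rintro L rfl hL
    exact fixedValue_le_deltaNonadaptive hx hnbr hε hL εg
  · refine (deltaNonadaptive_le ⟨x₀, x₁, hnbr⟩ hε k εg ?_).trans hlower
    rintro L rfl hL
    exact fixedValue_le_optValue hε hL _
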